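/- There is an absolute constant $K$ such that the following holds for all integers $n\ge 1$ and $\kappa\ge 1$. Let $U$ be a unitary acting on $n$ qubits, all of whose entries in the computational basis have the form $((a+b\sqrt2)+i(c+d\sqrt2))/\sqrt2^{\,\kappa}$ with integers $a,b,c,d$ (which may depend on the entry). Then $U$ can be implemented exactly using at most two ancillae and at most $K\cdot 4^n n\kappa$ Clifford and T gates. That is, for some $m\in\{0,1,2\}$ there is a circuit on $n+m$ qubits, consisting of at most $K\cdot 4^n n\kappa$ gates, each of them a Hadamard gate, a phase gate $\mathrm{diag}(1,i)$, a CNOT gate or a $T=\mathrm{diag}(1,e^{i\pi/4})$ gate, which maps $|\psi\rangle\otimes|0\rangle^{\otimes m}$ to $(U|\psi\rangle)\otimes|0\rangle^{\otimes m}$ for every $n$-qubit state $|\psi\rangle$. -/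

import Mathlib

namespace CliffordT

/-- The index set of the computational basis of `m` qubits: bit strings of length `m`. -/
abbrev Bits (m : ℕ) : Type := Fin m → Fin 2

/-- Operators on `m` qubits, as matrices in the computational basis. -/
abbrev Op (m : ℕ) : Type := Matrix (Bits m) (Bits m) ℂ

/-- The Hadamard gate. -/
noncomputable def hadamard : Matrix (Fin 2) (Fin 2) ℂ :=
  ((Real.sqrt 2 : ℝ) : ℂ)⁻¹ • !![1, 1; 1, -1]

/-- The phase gate. -/
noncomputable def phaseGate : Matrix (Fin 2) (Fin 2) ℂ :=
  !![1, 0; 0, Complex.I]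

/-- The T gate. -/
noncomputable def tGate : Matrix (Fin 2) (Fin 2) ℂ :=
  !![1, 0; 0, Complex.exp (Complex.I * (Real.pi : ℂ) / 4)]

/-- The operator on `m` qubits that acts as `A` on qubit `q` and as the identity on all others. -/
def onQubit {m : ℕ} (A : Matrix (Fin 2) (Fin 2) ℂ) (q : Fin m) : Op m :=
  Matrix.of fun x y => if ∀ j, j ≠ q → x j = y j then A (x q) (y q) else 0

/-- The controlled-NOT on `m` qubits, with control `c` and target `t`: it sends the basis state
`y` to the one in which bit `t` is replaced by `y t + y c` (addition modulo two). -/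
def cnotOp {m : ℕ} (c t : Fin m) : Op m :=
  Matrix.of fun x y => if x = Function.update y t (y t + y c) then 1 else 0

/-- The elementary gates on `m` qubits: the generators Hadamard, Phase and CNOT of the Clifford
circuits, and the T gate. -/
inductive Gate (m : ℕ) : Type
  | H (q : Fin m) : Gate m
  | S (q : Fin m) : Gate m
  | T (q : Fin m) : Gate m
  | CNOT (c t : Fin m) (h : c ≠ t) : Gate m

/-- The operator of a gate. -/
noncomputable def Gate.op {m : ℕ} : Gate m → Op m
  | .H q => onQubit hadamard q
  | .S q => onQubit phaseGate q
  | .T q => onQubit tGate q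
  | .CNOT c t _ => cnotOp c t

/-- A Clifford and T circuit on `m` qubits: a list of gates, the head of the list being applied
first. Its number of gates is the length of the list. -/
abbrev Circuit (m : ℕ) : Type := List (Gate m)

/-- The operator of a circuit. -/
noncomputable def Circuit.op {m : ℕ} : Circuit m → Op m
  | [] => 1
  | g :: gs => Circuit.op gs * g.op

/-- The state `|ψ⟩ ⊗ |0…0⟩` of `n + a` qubits: the `n`-qubit state `ψ`, followed by `a` ancillae
in the state zero. -/
def withAncillae {n : ℕ} (a : ℕ) (ψ : Bits n → ℂ) : Bits (n + a) → ℂ :=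
  fun z => if ∀ j : Fin a, z (Fin.natAdd n j) = 0 then ψ (fun i => z (Fin.castAdd a i)) else 0

/-- A circuit on `n + a` qubits implements the `n`-qubit operator `U` exactly, using `a`
ancillae: it maps `|ψ⟩ ⊗ |0…0⟩` to `(U|ψ⟩) ⊗ |0…0⟩` for every `ψ`. -/
def Circuit.Implements {n a : ℕ} (C : Circuit (n + a)) (U : Op n) : Prop :=
  ∀ ψ : Bits n → ℂ,
    (Circuit.op C).mulVec (withAncillae a ψ) = withAncillae a (U.mulVec ψ)

/-- The complex number `z` has the form `((a + b√2) + i(c + d√2)) / √2 ^ κ` with integers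
`a, b, c, d`. -/
def HasForm (κ : ℕ) (z : ℂ) : Prop :=
  ∃ a b c d : ℤ,
    z = (((a : ℂ) + (b : ℂ) * ((Real.sqrt 2 : ℝ) : ℂ)) +
          Complex.I * ((c : ℂ) + (d : ℂ) * ((Real.sqrt 2 : ℝ) : ℂ))) /
        ((Real.sqrt 2 : ℝ) : ℂ) ^ κ

end CliffordT

namespace CliffordT

open Matrix Function

/-! With one extra qubit, `U` becomes a product of reflections. The vectors `embedVec U j`, the
normalised differences of |j⟩|1⟩ and U|j⟩|0⟩, are orthonormal up to what is needed here: the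
reflection along the one for `j` swaps these two states and fixes those for other `j`. The product
of all 2^n reflections therefore sends |ψ⟩|1⟩ to U|ψ⟩|0⟩ (`reflProd_mulVec`), and an X gate supplies
the |1⟩.

Since a reflection along `B *ᵥ w` is the conjugate by `B` of the one along `w` (`refl_conj`), it
suffices to reduce a unit vector with entries in ℤ[ω]/√2^k to a basis state (`reflSynth_of_octInt`).
Comparing the coefficients of 1 and √2 in the norm equation shows that entries not divisible by √2
come in pairs of equal valuation at the prime above 2 (`exists_ne_weight_eq`). A Hadamard gate on
the plane of such a pair, after a suitable power of ω, raises both valuations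
(`exists_hadamard_step`). Once every entry is divisible by √2, the exponent k drops by one. This
takes O(k 2^n) two-level gates.

Two-level gates and reflections along basis states cost O(n) gates: they are conjugate to a phase on
the all-ones state, obtained from multi-controlled NOTs with borrowed bits and one clean ancilla
(`exists_phase_ones`). In total there are 2^n · O(κ 2^n) · O(n) gates. One ancilla is the embedding
qubit, the other the clean bit for the phases. -/

/-! ### Arithmetic of ω and √2. -/

/-- The primitive eighth root of unity in the T gate. -/
noncomputable def omega : ℂ := Complex.exp (Complex.I * (Real.pi : ℂ) / 4)

/-- The square root of two as a complex number. -/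
noncomputable def sqrtTwo : ℂ := ((Real.sqrt 2 : ℝ) : ℂ)

lemma sqrtTwo_sq : sqrtTwo ^ 2 = 2 := by
  unfold sqrtTwo
  rw [← Complex.ofReal_pow, Real.sq_sqrt (by norm_num)]
  norm_num

lemma sqrtTwo_ne_zero : sqrtTwo ≠ 0 := by
  intro h
  have := sqrtTwo_sq
  simp [h] at this

lemma sqrtTwo_inv_mul_inv : sqrtTwo⁻¹ * sqrtTwo⁻¹ = 2⁻¹ := by
  rw [← mul_inv, ← sq, sqrtTwo_sq]

lemma star_sqrtTwo : star sqrtTwo = sqrtTwo := Complex.conj_ofReal _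

lemma sqrtTwo_mul_omega : sqrtTwo * omega = 1 + Complex.I := by
  have h : omega = Complex.exp (((Real.pi / 4 : ℝ) : ℂ) * Complex.I) := by
    unfold omega; congr 1; push_cast; ring
  rw [h, Complex.exp_mul_I, ← Complex.ofReal_cos, ← Complex.ofReal_sin, Real.cos_pi_div_four,
    Real.sin_pi_div_four]
  have := sqrtTwo_sq
  unfold sqrtTwo at *
  push_cast
  linear_combination (1 + Complex.I) / 2 * this

lemma omega_sq : omega ^ 2 = Complex.I := by
  have h := sqrtTwo_mul_omega
  have h2 : 2 * omega ^ 2 = 2 * Complex.I := by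
    linear_combination (sqrtTwo * omega + 1 + Complex.I) * h - omega ^ 2 * sqrtTwo_sq
      + Complex.I_sq
  exact mul_left_cancel₀ two_ne_zero h2

lemma omega_pow_four : omega ^ 4 = -1 := by
  rw [show (4 : ℕ) = 2 * 2 from rfl, pow_mul, omega_sq, Complex.I_sq]

lemma omega_pow_eight : omega ^ 8 = 1 := by
  rw [show (8 : ℕ) = 4 * 2 from rfl, pow_mul, omega_pow_four]; norm_num

lemma omega_pow_mod (k : ℕ) : omega ^ (k % 8) = omega ^ k := by
  conv_rhs => rw [← Nat.div_add_mod k 8, pow_add, pow_mul, omega_pow_eight, one_pow, one_mul]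

lemma star_omega_mul : star omega * omega = 1 := by
  have h : omega = Complex.exp (((Real.pi / 4 : ℝ) : ℂ) * Complex.I) := by
    unfold omega; congr 1; push_cast; ring
  rw [h, Complex.star_def, ← Complex.normSq_eq_conj_mul_self, Complex.normSq_eq_norm_sq,
    Complex.norm_exp_ofReal_mul_I]
  norm_num

lemma omega_ne_zero : omega ≠ 0 := Complex.exp_ne_zero _

lemma star_omega : star omega = omega ^ 7 := by
  apply mul_right_cancel₀ omega_ne_zero
  rw [star_omega_mul, ← pow_succ, omega_pow_eight]

lemma sqrtTwo_eq : sqrtTwo = omega - omega ^ 3 := by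
  have h : sqrtTwo * omega = (omega - omega ^ 3) * omega := by
    linear_combination sqrtTwo_mul_omega - omega_sq + omega_pow_four
  exact mul_right_cancel₀ omega_ne_zero h

/-! ### Circuits that permute basis states up to phases. -/

variable {m : ℕ}

lemma Circuit.op_append (C D : Circuit m) : Circuit.op (C ++ D) = Circuit.op D * Circuit.op C := by
  induction C with
  | nil => simp [Circuit.op]
  | cons g C ih => simp [Circuit.op, ih, Matrix.mul_assoc]

lemma eq_update_of_agree {q : Fin m} {x y : Bits m} (h : ∀ j, j ≠ q → x j = y j) :
    y = update x q (y q) := by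
  ext j
  by_cases hj : j = q
  · subst hj; simp
  · simp [hj, h j hj]

lemma onQubit_mulVec (A : Matrix (Fin 2) (Fin 2) ℂ) (q : Fin m) (φ : Bits m → ℂ) (x : Bits m) :
    (onQubit A q *ᵥ φ) x = ∑ b, A (x q) b * φ (update x q b) := by
  simp only [mulVec, dotProduct, onQubit, Matrix.of_apply]
  symm
  apply Finset.sum_of_injOn (fun b => update x q b)
  · intro a _ b _ h
    simpa using congrFun h q
  · intro _ _; simp
  · intro y _ hy
    split_ifs with h
    · exact (hy ⟨y q, by simp, (eq_update_of_agree h).symm⟩).elim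
    · simp
  · intro b _
    rw [if_pos]
    · simp
    · intro j hj; simp [hj]

lemma cnotOp_mulVec {c t : Fin m} (h : c ≠ t) (φ : Bits m → ℂ) (x : Bits m) :
    (cnotOp c t *ᵥ φ) x = φ (update x t (x t + x c)) := by
  have key : ∀ a b : Fin 2, a + b + b = a := by decide
  simp only [mulVec, dotProduct, cnotOp, Matrix.of_apply]
  rw [Finset.sum_eq_single (update x t (x t + x c))]
  · simp [h, key]
  · intro y _ hy
    rw [if_neg, zero_mul]
    rintro rfl
    apply hy
    simp [h, key]
  · simp

/-- The circuit pulls a state back along the map `p` and then multiplies it with the phases `d`. -/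
def Circuit.Acts (C : Circuit m) (d : Bits m → ℂ) (p : Bits m → Bits m) : Prop :=
  ∀ φ x, (Circuit.op C *ᵥ φ) x = d x * φ (p x)

namespace Circuit.Acts

lemma nil : Acts ([] : Circuit m) (fun _ => 1) id := by
  intro φ x; simp [Circuit.op]

lemma append {C D : Circuit m} {c d : Bits m → ℂ} {p r : Bits m → Bits m}
    (hC : Acts C c p) (hD : Acts D d r) :
    Acts (C ++ D) (fun x => d x * c (r x)) (fun x => p (r x)) := by
  intro φ x
  rw [Circuit.op_append, ← Matrix.mulVec_mulVec, hD, hC, mul_assoc]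

lemma congr {C : Circuit m} {c d : Bits m → ℂ} {p r : Bits m → Bits m}
    (hC : Acts C c p) (h : ∀ x, c x = d x) (h' : ∀ x, p x = r x) : Acts C d r := by
  intro φ x; rw [hC, h, h']

lemma append_diag {C D : Circuit m} {c d : Bits m → ℂ}
    (hC : Acts C c id) (hD : Acts D d id) : Acts (C ++ D) (fun x => c x * d x) id :=
  (hC.append hD).congr (fun _ => mul_comm _ _) fun _ => rfl

lemma gateT (q : Fin m) : Acts [Gate.T q] (fun x => omega ^ (x q).val) id := by
  intro φ x
  simp only [Circuit.op, Gate.op, one_mul, onQubit_mulVec, Fin.sum_univ_two, tGate]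
  have : x q = 0 ∨ x q = 1 := by generalize x q = a; revert a; decide
  rcases this with h | h <;> simp [h, omega] <;> rw [← h] <;> simp

lemma gateT_pow (q : Fin m) (k : ℕ) :
    Acts (List.replicate k (Gate.T q)) (fun x => omega ^ (k * (x q).val)) id := by
  induction k with
  | zero => simpa using nil
  | succ k ih =>
    rw [List.replicate_succ']
    exact (ih.append_diag (gateT q)).congr (fun x => by rw [← pow_add]; ring_nf) fun _ => rfl

lemma gateCNOT {c t : Fin m} (h : c ≠ t) :
    Acts [Gate.CNOT c t h] (fun _ => 1) (fun x => update x t (x t + x c)) := by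
  intro φ x
  simp [Circuit.op, Gate.op, cnotOp_mulVec h]

lemma conj_CNOT {c t : Fin m} (h : c ≠ t) {D : Circuit m} {d : Bits m → ℂ} (hD : Acts D d id) :
    Acts ([Gate.CNOT c t h] ++ D ++ [Gate.CNOT c t h])
      (fun x => d (update x t (x t + x c))) id := by
  have key : ∀ a b : Fin 2, a + b + b = a := by decide
  refine (((gateCNOT h).append hD).append (gateCNOT h)).congr ?_ ?_
  · intro x; simp
  · intro x; simp [h, key]

lemma gateH_apply (q : Fin m) (φ : Bits m → ℂ) (x : Bits m) :
    (Circuit.op [Gate.H q] *ᵥ φ) x =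
      sqrtTwo⁻¹ * (φ (update x q 0) + (-1) ^ (x q).val * φ (update x q 1)) := by
  simp only [Circuit.op, Gate.op, one_mul, onQubit_mulVec, Fin.sum_univ_two, hadamard]
  have : x q = 0 ∨ x q = 1 := by generalize x q = a; revert a; decide
  change _ = (sqrtTwo)⁻¹ * _
  unfold sqrtTwo
  rcases this with h | h <;> simp [h] <;> ring

/-- A diagonal circuit with phases `g x * (-1) ^ (f x * x t)`, conjugated by a Hadamard gate on
`t`, adds `f x` to bit `t`, up to the phase `g x`. -/
lemma conj_H {t : Fin m} {D : Circuit m} {g : Bits m → ℂ} {f : Bits m → Fin 2}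
    (hg : ∀ x b, g (update x t b) = g x) (hf : ∀ x b, f (update x t b) = f x)
    (hD : Acts D (fun x => g x * (-1) ^ (f x * x t).val) id) :
    Acts ([Gate.H t] ++ D ++ [Gate.H t]) g (fun x => update x t (x t + f x)) := by
  intro φ x
  rw [Circuit.op_append, Circuit.op_append, ← Matrix.mulVec_mulVec, ← Matrix.mulVec_mulVec,
    gateH_apply, hD, hD, id, id, gateH_apply, gateH_apply]
  simp only [hg, hf, update_self, update_idem]
  have h2 : ∀ a : Fin 2, a = 0 ∨ a = 1 := by decide
  have h3 : (1 : Fin 2) + 1 = 0 := by decide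
  have h4 := sqrtTwo_inv_mul_inv
  generalize sqrtTwo⁻¹ = s at *
  rcases h2 (x t) with h | h <;> rcases h2 (f x) with h' | h' <;>
    simp only [h, h', h3, add_zero, zero_add, mul_zero, mul_one, Fin.val_zero,
      Fin.val_one, pow_zero, pow_one]
  · linear_combination 2 * g x * φ (update x t 0) * h4
  · linear_combination 2 * g x * φ (update x t 1) * h4
  · linear_combination 2 * g x * φ (update x t 1) * h4
  · linear_combination 2 * g x * φ (update x t 0) * h4

end Circuit.Acts

/-! ### Multi-controlled NOT and phase gates of linear size. -/

/-- Over the integers, 4abt = a + b + t − (a⊕b) − (a⊕t) − (b⊕t) + (a⊕b⊕t), and (−1)^(abt) =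
ω^(4abt). Each parity is computed in place by CNOTs; the seventh power of T stands for its inverse.
-/
lemma exists_ccz {a b t : Fin m} (hab : a ≠ b) (hat : a ≠ t) (hbt : b ≠ t) :
    ∃ C : Circuit m, C.length ≤ 35 ∧
      C.Acts (fun x => (-1) ^ (x a * x b * x t).val) id := by
  have h1 := ((Circuit.Acts.gateT a).append_diag (Circuit.Acts.gateT b)).append_diag
    (Circuit.Acts.gateT t)
  have h2 := ((Circuit.Acts.conj_CNOT hab (Circuit.Acts.gateT_pow b 7)).append_diag
    (Circuit.Acts.conj_CNOT hat (Circuit.Acts.gateT_pow t 7))).append_diag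
    (Circuit.Acts.conj_CNOT hbt (Circuit.Acts.gateT_pow t 7))
  have h3 := Circuit.Acts.conj_CNOT hat (Circuit.Acts.conj_CNOT hbt (Circuit.Acts.gateT t))
  refine ⟨_, ?_, ((h1.append_diag h2).append_diag h3).congr ?_ fun _ => rfl⟩
  · simp
  · intro x
    simp only [update_self, ne_eq, hbt, not_false_eq_true, update_of_ne, ← pow_add]
    have h2 : ∀ a : Fin 2, a = 0 ∨ a = 1 := by decide
    have h3 : (1 : Fin 2) + 1 = 0 := by decide
    have h16 : omega ^ 16 = 1 := by rw [← omega_pow_mod]; simp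
    rcases h2 (x a) with h | h <;> rcases h2 (x b) with h' | h' <;> rcases h2 (x t) with h'' | h''
      <;> simp [h, h', h'', h3, h16, omega_pow_four]

lemma exists_toffoli {a b t : Fin m} (hab : a ≠ b) (hat : a ≠ t) (hbt : b ≠ t) :
    ∃ C : Circuit m, C.length ≤ 37 ∧
      C.Acts (fun _ => 1) (fun x => update x t (x t + x a * x b)) := by
  obtain ⟨C, hl, hC⟩ := exists_ccz hab hat hbt
  refine ⟨_, ?_, Circuit.Acts.conj_H (g := fun _ => 1) (f := fun x => x a * x b) (t := t) (D := C)
    (fun _ _ => rfl) (fun x c => by simp [hat, hbt]) (hC.congr (fun x => by simp) fun _ => rfl)⟩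
  simp; omega

/-- The conjunction of the bits in a list of positions. -/
def allBits (cs : List (Fin m)) (x : Bits m) : Fin 2 := cs.foldr (fun c r => x c * r) 1

lemma allBits_congr {cs : List (Fin m)} {x y : Bits m} (h : ∀ c ∈ cs, x c = y c) :
    allBits cs x = allBits cs y := by
  induction cs with
  | nil => rfl
  | cons c cs ih =>
    simp only [List.mem_cons, forall_eq_or_imp] at h
    have := ih h.2
    simp only [allBits, List.foldr_cons] at *
    rw [this, h.1]

lemma allBits_update {cs : List (Fin m)} {t : Fin m} (h : t ∉ cs) (x : Bits m) (b : Fin 2) :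
    allBits cs (update x t b) = allBits cs x :=
  allBits_congr fun c hc => update_of_ne (by rintro rfl; exact h hc) _ _

lemma allBits_append (cs ds : List (Fin m)) (x : Bits m) :
    allBits (cs ++ ds) x = allBits cs x * allBits ds x := by
  have h1 : ∀ a : Fin 2, 1 * a = a := by decide
  have h2 : ∀ a b c : Fin 2, a * (b * c) = a * b * c := by decide
  induction cs with
  | nil => simp [allBits]
  | cons c cs ih => simp only [allBits, List.cons_append, List.foldr_cons] at *; rw [ih, h2]

lemma allBits_eq_one_iff (cs : List (Fin m)) (x : Bits m) :
    allBits cs x = 1 ↔ ∀ c ∈ cs, x c = 1 := by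
  have h1 : ∀ a b : Fin 2, a * b = 1 ↔ a = 1 ∧ b = 1 := by decide
  induction cs with
  | nil => simp [allBits]
  | cons c cs ih =>
    simp only [allBits, List.foldr_cons, List.forall_mem_cons] at *
    rw [h1]
    exact and_congr_right fun _ => ih

/-- A ladder of Toffoli gates adds the conjunction of the bits `cs` to bit `t` and may change
the borrowed bits `as`, but is an involution. -/
lemma exists_ladder : ∀ (cs as : List (Fin m)) (t : Fin m), cs ≠ [] → (cs ++ (as ++ [t])).Nodup →
    cs.length ≤ as.length + 1 →
    ∃ (C : Circuit m) (p : Bits m → Bits m), C.length ≤ 74 * cs.length ∧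
      C.Acts (fun _ => 1) p ∧ Involutive p ∧ (∀ x, p x t = x t + allBits cs x) ∧
      (∀ x j, j ∉ as → j ≠ t → p x j = x j) ∧
      ∀ x j b, j ∉ cs → j ∉ as → j ≠ t → p (update x j b) = update (p x) j b
  | [], _, _, h, _, _ => (h rfl).elim
  | [c], as, t, _, hnd, _ => by
    have hct : c ≠ t := by
      rintro rfl
      simp at hnd
    have key : ∀ a b : Fin 2, a + b + b = a := by decide
    refine ⟨_, _, ?_, Circuit.Acts.gateCNOT hct, ?_, ?_, ?_, ?_⟩
    · simp
    · intro x; simp [hct, key]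
    · intro x; simp [allBits]
    · intro x j _ hj; simp [hj]
    · intro x j b hj _ hjt
      have hj : c ≠ j := by simpa [eq_comm] using hj
      rw [update_of_ne hjt.symm, update_of_ne hj, update_comm hjt]
  | c :: c' :: cs, [], t, _, _, hl => by simp at hl
  | c :: c' :: cs, a :: as, t, _, hnd, hl => by
    have hca : c ≠ a := by rintro rfl; simp at hnd
    have hct : c ≠ t := by rintro rfl; simp at hnd
    have hat : a ≠ t := by
      rintro rfl
      have := hnd.of_append_right
      simp at this
    obtain ⟨B, β, hB, hβ, hinv, hadd, hfix, hcomm⟩ := exists_ladder (c' :: cs) as a (by simp)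
      (by
        refine (List.Perm.nodup_iff ?_).1 (List.Nodup.sublist
          (l₁ := c' :: cs ++ (a :: as)) ?_ hnd)
        · exact List.Perm.append_left _ (List.perm_append_singleton a as).symm
        · simp only [List.cons_append]
          refine List.Sublist.cons _ (List.Sublist.cons_cons _ ?_)
          exact List.Sublist.append_left (List.Sublist.cons_cons _ (List.sublist_append_left _ _)) _)
      (by simpa using hl)
    obtain ⟨C, hC, hτ⟩ := exists_toffoli hca hct hat
    have htcs : t ∉ c' :: cs := by
      intro h
      have := (List.nodup_append.1 hnd).2.2 t (List.mem_cons_of_mem _ h) t (by simp)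
      exact this rfl
    have htas : t ∉ as := by
      intro h
      have := (List.nodup_append.1 (hnd.of_append_right)).2.2 t (List.mem_cons_of_mem _ h) t
        (by simp)
      exact this rfl
    have hcas : c ∉ as := by
      intro h
      have := (List.nodup_append.1 hnd).2.2 c (by simp) c (by simp [h])
      exact this rfl
    have hβτ : ∀ x b, β (update x t b) = update (β x) t b := fun x b =>
      hcomm x t b htcs htas hat.symm
    -- The target receives `a * b` before and `a * (b + v)` after the shorter ladder has added `v`
    -- to the borrowed bit `b`; the unknown `b` cancels.
    have key1 : ∀ a b u v : Fin 2, u + a * b + a * (b + v) = u + a * v := by decide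
    have key : ∀ x, update (β (update x t (x t + x c * x a))) t
        ((β (update x t (x t + x c * x a))) t + (β (update x t (x t + x c * x a))) c *
          (β (update x t (x t + x c * x a))) a) =
        update (β x) t (x t + allBits (c :: c' :: cs) x) := by
      intro x
      rw [hβτ]
      simp only [update_self, ne_eq, hct, hat, not_false_eq_true, update_of_ne, update_idem]
      rw [hfix x c hcas hca, hadd, key1]
      rfl
    refine ⟨C ++ B ++ C, fun x => update (β x) t (x t + allBits (c :: c' :: cs) x), ?_,
      (((hτ.append hβ).append hτ).congr ?_ key), ?_, ?_, ?_, ?_⟩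
    · simp only [List.length_append, List.length_cons] at *
      omega
    · simp
    · intro x
      have h2 : allBits (c :: c' :: cs) (update (β x) t (x t + allBits (c :: c' :: cs) x)) =
          allBits (c :: c' :: cs) x := by
        rw [allBits_update (by simp only [List.mem_cons, not_or] at htcs ⊢; exact ⟨hct.symm, htcs⟩)]
        refine allBits_congr fun e he => hfix x e ?_ ?_
        · intro h
          exact (List.nodup_append.1 hnd).2.2 e he e (by simp [h]) rfl
        · rintro rfl
          exact (List.nodup_append.1 hnd).2.2 e he e (by simp) rfl
      have key2 : ∀ a b : Fin 2, a + b + b = a := by decide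
      simp only [h2, update_self, hβτ, update_idem, key2, hinv x, update_eq_self]
    · intro x; simp
    · intro x j hj hjt
      simp only [List.mem_cons, not_or] at hj
      simp only [update_of_ne hjt, hfix x j hj.2 hj.1]
    · intro x j b hj hja hjt
      simp only [List.mem_cons, not_or] at hja
      have hj' := hj
      rw [List.mem_cons, not_or] at hj'
      simp only [hcomm x j b hj'.2 hja.2 hja.1, allBits_update hj, update_of_ne (Ne.symm hjt)]
      rw [update_comm hjt]

/-- One more pass of the shorter ladder after Toffoli–ladder–Toffoli restores all borrowed bits,
because the ladder is an involution that ignores the target `t`. -/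
lemma exists_mcx {cs as : List (Fin m)} {t : Fin m} (hcs : cs ≠ [])
    (hnd : (cs ++ (as ++ [t])).Nodup) (hl : cs.length ≤ as.length + 1) :
    ∃ C : Circuit m, C.length ≤ 148 * cs.length ∧
      C.Acts (fun _ => 1) (fun x => update x t (x t + allBits cs x)) := by
  have hmem : ∀ e ∈ cs, e ∉ as ∧ e ≠ t := fun e he =>
    ⟨fun h => (List.nodup_append.1 hnd).2.2 e he e (by simp [h]) rfl,
      fun h => (List.nodup_append.1 hnd).2.2 e he e (by simp [h]) rfl⟩
  match cs, as, hcs, hl with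
  | [c], as, _, _ =>
    have hct : c ≠ t := (hmem c (by simp)).2
    exact ⟨_, by simp, (Circuit.Acts.gateCNOT hct).congr (fun _ => rfl) fun x => by
      simp [allBits]⟩
  | c :: c' :: cs, [], _, hl => simp at hl
  | c :: c' :: cs, a :: as, _, hl =>
    have hca : c ≠ a := fun h => (hmem c (by simp)).1 (by simp [h])
    have hct : c ≠ t := (hmem c (by simp)).2
    have htas : t ∉ a :: as := fun h =>
      (List.nodup_append.1 hnd.of_append_right).2.2 t h t (by simp) rfl
    have hat : a ≠ t := fun h => htas (by simp [h])
    have htcs : t ∉ c' :: cs := fun h => (hmem t (List.mem_cons_of_mem _ h)).2 rfl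
    obtain ⟨B, β, hB, hβ, hinv, hadd, hfix, hcomm⟩ := exists_ladder (c' :: cs) as a (by simp)
      (by
        refine (List.Perm.nodup_iff ?_).1 (List.Nodup.sublist
          (l₁ := c' :: cs ++ (a :: as)) ?_ hnd)
        · exact List.Perm.append_left _ (List.perm_append_singleton a as).symm
        · simp only [List.cons_append]
          refine List.Sublist.cons _ (List.Sublist.cons_cons _ ?_)
          exact List.Sublist.append_left (List.Sublist.cons_cons _ (List.sublist_append_left _ _)) _)
      (by simpa using hl)
    obtain ⟨C, hC, hτ⟩ := exists_toffoli hca hct hat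
    have hcas : c ∉ as := fun h => (hmem c (by simp)).1 (by simp [h])
    refine ⟨C ++ B ++ C ++ B, ?_,
      ((((hτ.append hβ).append hτ).append hβ).congr (fun _ => by simp) fun x => ?_)⟩
    · simp only [List.length_append, List.length_cons] at *
      omega
    · have key1 : ∀ a b u v : Fin 2, u + a * (b + v) + a * b = u + a * v := by decide
      have htas' : t ∉ as := fun h => htas (List.mem_cons_of_mem _ h)
      simp only [hcomm _ t _ htcs htas' hat.symm, hinv x, update_self, update_idem, ne_eq, hct, hat,
        not_false_eq_true, update_of_ne]
      rw [hfix x c hcas hca, hfix x t htas' hat.symm, hadd, key1]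
      rfl

/-- The controlled phase `-iZ` with controls `cs ++ ds`, as a commutator of multi-controlled
NOT gates and T gates. -/
lemma exists_controlled_phase {cs ds : List (Fin m)} {t : Fin m} (hcs : cs ≠ []) (hds : ds ≠ [])
    (hnd : (cs ++ (ds ++ [t])).Nodup) (h1 : cs.length ≤ ds.length + 1)
    (h2 : ds.length ≤ cs.length + 1) :
    ∃ C : Circuit m, C.length ≤ 296 * (cs ++ ds).length + 16 ∧
      C.Acts (fun x => (-Complex.I) ^ (allBits (cs ++ ds) x).val *
        (-1) ^ (allBits (cs ++ ds) x * x t).val) id := by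
  obtain ⟨A, hA, ha⟩ := exists_mcx hcs hnd h1
  have hnd' : (ds ++ (cs ++ [t])).Nodup := by
    rw [← List.append_assoc] at hnd ⊢
    exact (List.Perm.nodup_iff (List.Perm.append_right _ List.perm_append_comm)).1 hnd
  obtain ⟨B, hB, hb⟩ := exists_mcx hds hnd' h2
  have htc : t ∉ cs := fun h => (List.nodup_append.1 hnd).2.2 t h t (by simp) rfl
  have htd : t ∉ ds := fun h => (List.nodup_append.1 hnd').2.2 t h t (by simp) rfl
  have hT := Circuit.Acts.gateT t
  have hT7 := Circuit.Acts.gateT_pow t 7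
  have h01 : ∀ a : Fin 2, a = 0 ∨ a = 1 := by decide
  have h11 : (1 : Fin 2) + 1 = 0 := by decide
  -- With c and d the conjunctions of `cs` and `ds`, the exponent of ω is t − (t⊕c) + (t⊕c⊕d) −
  -- (t⊕d). It vanishes unless c = d = 1, when it is −2 for t = 0 and 2 for t = 1.
  refine ⟨_, ?_, (((((((hT.append ha).append hT7).append hb).append hT).append
    ha).append hT7).append hb).congr ?_ ?_⟩
  · simp only [List.length_append, List.length_cons, List.length_nil, List.length_replicate]
    omega
  · intro x
    have h14 : omega ^ 14 = -Complex.I := by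
      rw [← omega_pow_mod, show 14 % 8 = 4 + 2 from rfl, pow_add, omega_pow_four, omega_sq]
      ring
    have h16 : omega ^ 16 = 1 := by rw [← omega_pow_mod]; simp
    simp only [id, allBits_update htc, allBits_update htd, update_self, update_idem,
      allBits_append, one_mul, ← pow_add]
    rcases h01 (allBits cs x) with h | h <;> rcases h01 (allBits ds x) with h' | h' <;>
      rcases h01 (x t) with h'' | h'' <;>
      simp [h, h', h'', h11, h14, h16, omega_pow_eight, omega_sq]
  · intro x
    have key : ∀ a b c : Fin 2, a + c + b + c + b = a := by decide
    simp only [id, allBits_update htc, allBits_update htd, update_self, update_idem, key,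
      update_eq_self]

/-- The phase `omega ^ k` on the basis state of `n` ones, with one clean ancilla. -/
lemma exists_phase_ones (n : ℕ) (hn : 2 ≤ n) (k : ℕ) :
    ∃ C : Circuit (n + 1), C.length ≤ 592 * n + 50 ∧ ∀ ψ : Bits n → ℂ,
      Circuit.op C *ᵥ withAncillae 1 ψ =
        withAncillae 1 (fun x => if x = 1 then omega ^ k * ψ x else ψ x) := by
  set t : Fin (n + 1) := Fin.last n with ht
  set l : List (Fin (n + 1)) := (List.finRange n).map Fin.castSucc with hl
  have hll : l.length = n := by simp [hl]
  have hlnd : (l ++ [t]).Nodup := by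
    rw [List.nodup_append]
    refine ⟨(List.nodup_finRange n).map (Fin.castSucc_injective n), by simp, ?_⟩
    intro a ha b hb
    simp only [hl, List.mem_map, List.mem_finRange, true_and] at ha
    obtain ⟨i, rfl⟩ := ha
    simp only [List.mem_singleton] at hb
    rw [hb, ht]
    exact (Fin.castSucc_lt_last i).ne
  have hsplit := List.take_append_drop (n / 2) l
  -- Each half of the qubits lends its bits to the multi-controlled NOT of the other half; `2 ≤ n`
  -- makes both halves nonempty.
  obtain ⟨D, hD, hd⟩ := exists_controlled_phase (cs := l.take (n / 2)) (ds := l.drop (n / 2))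
    (t := t) (by rw [← List.length_pos_iff]; simp [hll]; omega)
    (by rw [← List.length_pos_iff]; simp [hll]; omega)
    (by rw [← List.append_assoc, hsplit]; exact hlnd)
    (by simp [hll]; omega) (by simp [hll]; omega)
  rw [hsplit] at hD hd
  have htl : t ∉ l := fun h => (List.nodup_append.1 hlnd).2.2 t h t (by simp) rfl
  have hV := Circuit.Acts.conj_H (g := fun x => (-Complex.I) ^ (allBits l x).val)
    (f := allBits l) (t := t) (fun x b => by simp only [allBits_update htl])
    (fun x b => allBits_update htl x b) hd
  -- The conjunction is written to the ancilla, a phase is applied there, and the conjunction is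
  -- erased. Writing and erasing each cost a factor −i, together −1 = ω^4, which the 4 in the
  -- exponent compensates.
  have hW := (hV.append (Circuit.Acts.gateT_pow t ((k + 4) % 8))).append hV
  refine ⟨[Gate.H t] ++ D ++ [Gate.H t] ++ List.replicate ((k + 4) % 8) (Gate.T t) ++
    ([Gate.H t] ++ D ++ [Gate.H t]), ?_, fun ψ => ?_⟩
  · simp only [List.length_append, List.length_cons, List.length_nil, List.length_replicate]
    omega
  · ext x
    rw [hW]
    have key : ∀ a b : Fin 2, a + b + b = a := by decide
    simp only [id, allBits_update htl, update_self, update_idem, key, update_eq_self]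
    simp only [withAncillae]
    have hz : (∀ j : Fin 1, x (Fin.natAdd n j) = 0) ↔ x t = 0 := by
      simp [ht, Fin.natAdd, Fin.last]
    have hone : allBits l x = 1 ↔ (fun i => x (Fin.castAdd 1 i)) = 1 := by
      rw [allBits_eq_one_iff, funext_iff]
      simp only [hl, List.mem_map, List.mem_finRange, true_and, forall_exists_index,
        forall_apply_eq_imp_iff]
      rfl
    have h01 : ∀ a : Fin 2, a = 0 ∨ a = 1 := by decide
    simp only [hz]
    split_ifs with h h'
    · rw [hone.2 h', h, zero_add, Fin.val_one, mul_one, omega_pow_mod, pow_add, omega_pow_four]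
      linear_combination -omega ^ k * ψ (fun i => x (Fin.castAdd 1 i)) * Complex.I_sq
    · have := (h01 (allBits l x)).resolve_right fun e => h' (hone.1 e)
      rw [this, h]
      simp
    · simp

/-! ### Synthesis with one clean ancilla, and the elementary gates. -/

variable {n : ℕ}

/-- An operator implementable with one ancilla and at most `L` gates. -/
def Synth (V : Op n) (L : ℕ) : Prop :=
  ∃ C : Circuit (n + 1), Circuit.Implements (a := 1) C V ∧ C.length ≤ L

lemma Synth.mono {V : Op n} {L L' : ℕ} (h : Synth V L) (hL : L ≤ L') : Synth V L' := by
  obtain ⟨C, hC, hl⟩ := h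
  exact ⟨C, hC, hl.trans hL⟩

lemma Synth.one : Synth (1 : Op n) 0 :=
  ⟨[], fun ψ => by simp [Circuit.op], by simp⟩

lemma Synth.mul {V W : Op n} {L L' : ℕ} (hV : Synth V L) (hW : Synth W L') :
    Synth (V * W) (L + L') := by
  obtain ⟨C, hC, hl⟩ := hV
  obtain ⟨D, hD, hl'⟩ := hW
  refine ⟨D ++ C, fun ψ => ?_, ?_⟩
  · rw [Circuit.op_append, ← mulVec_mulVec, hD, hC, mulVec_mulVec]
  · rw [List.length_append]; omega

lemma withAncillae_one_apply (ψ : Bits n → ℂ) (x : Bits (n + 1)) :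
    withAncillae 1 ψ x = if x (Fin.last n) = 0 then ψ (fun i => x i.castSucc) else 0 := by
  have hz : (∀ j : Fin 1, x (Fin.natAdd n j) = 0) ↔ x (Fin.last n) = 0 := by
    simp [Fin.natAdd, Fin.last]
  simp only [withAncillae, hz]
  rfl

lemma withAncillae_one_update (ψ : Bits n → ℂ) (x : Bits (n + 1)) (q : Fin n) (b : Fin 2) :
    withAncillae 1 ψ (update x q.castSucc b) =
      if x (Fin.last n) = 0 then ψ (update (fun i => x i.castSucc) q b) else 0 := by
  rw [withAncillae_one_apply, update_of_ne (Fin.castSucc_lt_last q).ne']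
  congr 2
  ext i
  by_cases h : i = q
  · subst h; simp
  · simp [h]

lemma onQubit_withAncillae (A : Matrix (Fin 2) (Fin 2) ℂ) (q : Fin n) (ψ : Bits n → ℂ) :
    onQubit A q.castSucc *ᵥ withAncillae 1 ψ = withAncillae 1 (onQubit A q *ᵥ ψ) := by
  ext x
  rw [onQubit_mulVec, withAncillae_one_apply]
  simp only [withAncillae_one_update, onQubit_mulVec]
  split_ifs <;> simp

lemma Synth.gate : ∀ g : Gate n, Synth g.op 1
  | .H q => ⟨[.H q.castSucc], fun ψ => by
      simpa [Circuit.op, Gate.op] using onQubit_withAncillae _ q ψ, by simp⟩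
  | .S q => ⟨[.S q.castSucc], fun ψ => by
      simpa [Circuit.op, Gate.op] using onQubit_withAncillae _ q ψ, by simp⟩
  | .T q => ⟨[.T q.castSucc], fun ψ => by
      simpa [Circuit.op, Gate.op] using onQubit_withAncillae _ q ψ, by simp⟩
  | .CNOT c t h => ⟨[.CNOT c.castSucc t.castSucc (by simpa using h)], fun ψ => by
      ext x
      simp only [Circuit.op, Gate.op, one_mul]
      rw [cnotOp_mulVec (by simpa using h), withAncillae_one_update, withAncillae_one_apply]
      simp only [cnotOp_mulVec h], by simp⟩

/-- A unitary such that it and its inverse are implementable with one ancilla and at most `L`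
gates. -/
def SynthUnitary (V : Op n) (L : ℕ) : Prop := Vᴴ * V = 1 ∧ Synth V L ∧ Synth Vᴴ L

namespace SynthUnitary

lemma mono {V : Op n} {L L' : ℕ} (h : SynthUnitary V L) (hL : L ≤ L') : SynthUnitary V L' :=
  ⟨h.1, h.2.1.mono hL, h.2.2.mono hL⟩

lemma conjTranspose {V : Op n} {L : ℕ} (h : SynthUnitary V L) : SynthUnitary Vᴴ L :=
  ⟨by rw [conjTranspose_conjTranspose]; exact mul_eq_one_comm.1 h.1, h.2.2,
    by rw [conjTranspose_conjTranspose]; exact h.2.1⟩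

lemma mul {V W : Op n} {L L' : ℕ} (hV : SynthUnitary V L) (hW : SynthUnitary W L') :
    SynthUnitary (V * W) (L + L') := by
  refine ⟨?_, hV.2.1.mul hW.2.1, ?_⟩
  · rw [conjTranspose_mul, Matrix.mul_assoc, ← Matrix.mul_assoc Vᴴ, hV.1, Matrix.one_mul, hW.1]
  · rw [conjTranspose_mul, add_comm]
    exact hW.2.2.mul hV.2.2

end SynthUnitary

lemma op_ext {V W : Op n} (h : ∀ φ x, (V *ᵥ φ) x = (W *ᵥ φ) x) : V = W :=
  Matrix.ext_of_mulVec_single fun i => by ext x; exact h _ x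

lemma onQubit_mul (A B : Matrix (Fin 2) (Fin 2) ℂ) (q : Fin n) :
    onQubit (A * B) q = onQubit A q * onQubit B q := by
  refine op_ext fun φ x => ?_
  rw [← mulVec_mulVec]
  simp only [onQubit_mulVec, update_self, update_idem, Fin.sum_univ_two, Matrix.mul_apply]
  ring

lemma onQubit_one (q : Fin n) : onQubit 1 q = (1 : Op n) := by
  refine op_ext fun φ x => ?_
  rw [onQubit_mulVec, one_mulVec, Finset.sum_eq_single (x q)]
  · simp
  · intro b _ hb; simp [hb.symm]
  · simp

lemma onQubit_conjTranspose (A : Matrix (Fin 2) (Fin 2) ℂ) (q : Fin n) :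
    (onQubit A q)ᴴ = onQubit Aᴴ q := by
  ext x y
  simp only [conjTranspose_apply, onQubit, Matrix.of_apply]
  have : (∀ j, j ≠ q → y j = x j) ↔ ∀ j, j ≠ q → x j = y j :=
    forall₂_congr fun _ _ => eq_comm
  simp only [this]
  split_ifs <;> simp

lemma hadamard_conjTranspose : hadamardᴴ = hadamard := by
  have h : (starRingEnd ℂ) ((Real.sqrt 2 : ℝ) : ℂ) = ((Real.sqrt 2 : ℝ) : ℂ) := Complex.conj_ofReal _
  ext i j
  fin_cases i <;> fin_cases j <;> simp [hadamard, conjTranspose_apply]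

lemma hadamard_mul_self : hadamard * hadamard = 1 := by
  have h : ((Real.sqrt 2 : ℝ) : ℂ)⁻¹ * ((Real.sqrt 2 : ℝ) : ℂ)⁻¹ = 2⁻¹ := sqrtTwo_inv_mul_inv
  unfold hadamard
  ext i j
  fin_cases i <;> fin_cases j <;> simp [Matrix.mul_apply, h] <;> norm_num

lemma phaseGate_pow (k : ℕ) : phaseGate ^ k = !![1, 0; 0, Complex.I ^ k] := by
  induction k with
  | zero => simp [Matrix.one_fin_two]
  | succ k ih => rw [pow_succ, ih, phaseGate, pow_succ]; simp

lemma tGate_pow (k : ℕ) : tGate ^ k = !![1, 0; 0, omega ^ k] := by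
  induction k with
  | zero => simp [Matrix.one_fin_two]
  | succ k ih => rw [pow_succ, ih, tGate, pow_succ]; simp [omega]

lemma onQubit_pow (A : Matrix (Fin 2) (Fin 2) ℂ) (q : Fin n) (k : ℕ) :
    onQubit (A ^ k) q = onQubit A q ^ k := by
  induction k with
  | zero => simp [onQubit_one]
  | succ k ih => rw [pow_succ, pow_succ, onQubit_mul, ih]

lemma Synth.pow {V : Op n} {L : ℕ} (hV : Synth V L) (k : ℕ) : Synth (V ^ k) (k * L) := by
  induction k with
  | zero => simpa using Synth.one
  | succ k ih => rw [pow_succ, Nat.succ_mul]; exact ih.mul hV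

/-- The bound 7 is common to all generators; it is forced by T, whose inverse is its seventh power.
-/
lemma synthUnitary_hadamard (q : Fin n) : SynthUnitary (onQubit hadamard q) 7 := by
  refine ⟨?_, (Synth.gate (.H q)).mono (by norm_num), ?_⟩
  · rw [onQubit_conjTranspose, hadamard_conjTranspose, ← onQubit_mul, hadamard_mul_self,
      onQubit_one]
  · rw [onQubit_conjTranspose, hadamard_conjTranspose]
    exact (Synth.gate (.H q)).mono (by norm_num)

lemma synthUnitary_phaseGate (q : Fin n) : SynthUnitary (onQubit phaseGate q) 7 := by
  have h : phaseGateᴴ = phaseGate ^ 3 := by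
    rw [phaseGate_pow]
    ext i j
    fin_cases i <;> fin_cases j <;> simp [phaseGate, conjTranspose_apply]
  have h4 : phaseGate ^ 4 = 1 := by
    rw [phaseGate_pow]; simp [Matrix.one_fin_two]
  refine ⟨?_, (Synth.gate (.S q)).mono (by norm_num), ?_⟩
  · rw [onQubit_conjTranspose, h, ← onQubit_mul, ← pow_succ, h4, onQubit_one]
  · rw [onQubit_conjTranspose, h, onQubit_pow]
    exact ((Synth.gate (.S q)).pow 3).mono (by norm_num)

lemma synthUnitary_tGate (q : Fin n) : SynthUnitary (onQubit tGate q) 7 := by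
  have h : tGateᴴ = tGate ^ 7 := by
    rw [tGate_pow, ← star_omega]
    ext i j
    fin_cases i <;> fin_cases j <;> simp [tGate, conjTranspose_apply, omega]
  have h4 : tGate ^ 8 = 1 := by
    rw [tGate_pow, omega_pow_eight]; simp [Matrix.one_fin_two]
  refine ⟨?_, (Synth.gate (.T q)).mono (by norm_num), ?_⟩
  · rw [onQubit_conjTranspose, h, ← onQubit_mul, ← pow_succ, h4, onQubit_one]
  · rw [onQubit_conjTranspose, h, onQubit_pow]
    exact ((Synth.gate (.T q)).pow 7).mono (by norm_num)

lemma cnotOp_conjTranspose {c t : Fin n} (h : c ≠ t) : (cnotOp c t)ᴴ = cnotOp c t := by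
  have key : ∀ a b : Fin 2, a + b + b = a := by decide
  have hs : ∀ x y : Bits n, x = update y t (y t + y c) → y = update x t (x t + x c) := by
    rintro x y rfl; simp [h, key]
  ext x y
  simp only [conjTranspose_apply, cnotOp, Matrix.of_apply]
  simp only [show (y = update x t (x t + x c)) ↔ (x = update y t (y t + y c)) from
    ⟨hs y x, hs x y⟩]
  split_ifs <;> simp

lemma synthUnitary_cnotOp {c t : Fin n} (h : c ≠ t) : SynthUnitary (cnotOp c t) 7 := by
  have key : ∀ a b : Fin 2, a + b + b = a := by decide
  have hs : Synth (cnotOp c t) 7 := (Synth.gate (.CNOT c t h)).mono (by norm_num)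
  refine ⟨?_, hs, by rwa [cnotOp_conjTranspose h]⟩
  rw [cnotOp_conjTranspose h]
  refine op_ext fun φ x => ?_
  rw [← mulVec_mulVec, cnotOp_mulVec h, cnotOp_mulVec h]
  simp [h, key]

/-- The Pauli X matrix. -/
def pauliX : Matrix (Fin 2) (Fin 2) ℂ := !![0, 1; 1, 0]

lemma synthUnitary_pauliX (q : Fin n) : SynthUnitary (onQubit pauliX q) 28 := by
  have h : pauliX = hadamard * (phaseGate * phaseGate) * hadamard := by
    have h : ((Real.sqrt 2 : ℝ) : ℂ)⁻¹ * ((Real.sqrt 2 : ℝ) : ℂ)⁻¹ = 2⁻¹ := sqrtTwo_inv_mul_inv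
    rw [← sq phaseGate, phaseGate_pow]
    unfold hadamard pauliX
    ext i j
    fin_cases i <;> fin_cases j <;> simp [Matrix.mul_apply, h] <;> norm_num
  rw [h, onQubit_mul, onQubit_mul, onQubit_mul]
  have hH := synthUnitary_hadamard q
  have hS := synthUnitary_phaseGate q
  exact (hH.mul (hS.mul hS)).mul hH

/-- A Clifford and T matrix that diagonalizes the Hadamard matrix. -/
noncomputable def diagHadamard : Matrix (Fin 2) (Fin 2) ℂ :=
  phaseGate * hadamard * tGate * hadamard

lemma synthUnitary_diagHadamard (q : Fin n) : SynthUnitary (onQubit diagHadamard q) 28 := by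
  rw [diagHadamard, onQubit_mul, onQubit_mul, onQubit_mul]
  have hH := synthUnitary_hadamard q
  exact (((synthUnitary_phaseGate q).mul hH).mul (synthUnitary_tGate q)).mul hH

/-- The second column of `diagHadamard` is a unit eigenvector of the Hadamard matrix for the
eigenvalue −1. -/
lemma diagHadamard_zero_one : diagHadamard 0 1 = (1 - omega) / 2 := by
  have h : ((Real.sqrt 2 : ℝ) : ℂ)⁻¹ * ((Real.sqrt 2 : ℝ) : ℂ)⁻¹ = 2⁻¹ := sqrtTwo_inv_mul_inv
  simp only [diagHadamard, phaseGate, hadamard, tGate, Matrix.mul_apply, Fin.sum_univ_two]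
  simp
  change _ + -(_ * omega * _) = _
  linear_combination (1 - omega) * h

lemma diagHadamard_one_one : diagHadamard 1 1 = Complex.I * (1 + omega) / 2 := by
  have h : ((Real.sqrt 2 : ℝ) : ℂ)⁻¹ * ((Real.sqrt 2 : ℝ) : ℂ)⁻¹ = 2⁻¹ := sqrtTwo_inv_mul_inv
  simp only [diagHadamard, phaseGate, hadamard, tGate, Matrix.mul_apply, Fin.sum_univ_two]
  simp
  change _ + (_ * omega * _) = _
  linear_combination Complex.I * (1 + omega) * h

/-! ### Reflections and their conjugation. -/

/-- The operator that multiplies the unit vector `w` by `ζ` and fixes its orthogonal complement. -/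
def refl (ζ : ℂ) (w : Bits n → ℂ) : Op n := 1 - (1 - ζ) • vecMulVec w (star w)

lemma refl_mulVec (ζ : ℂ) (w φ : Bits n → ℂ) :
    refl ζ w *ᵥ φ = φ - ((1 - ζ) * (star w ⬝ᵥ φ)) • w := by
  rw [refl, sub_mulVec, one_mulVec, smul_mulVec, vecMulVec_mulVec]
  ext x
  simp [mul_comm, mul_left_comm]

/-- Global phases do not matter, so it is enough to reduce a vector to a multiple of a basis state.
-/
lemma refl_smul {ζ c : ℂ} (hc : c * star c = 1) (w : Bits n → ℂ) : refl ζ (c • w) = refl ζ w := by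
  unfold refl
  congr 2
  ext x y
  simp only [vecMulVec_apply, Pi.smul_apply, smul_eq_mul, Pi.star_apply, star_mul']
  linear_combination w x * star (w y) * hc

lemma refl_conj {B : Op n} (hB : Bᴴ * B = 1) (ζ : ℂ) (w : Bits n → ℂ) :
    refl ζ (B *ᵥ w) = B * refl ζ w * Bᴴ := by
  unfold refl
  rw [Matrix.mul_sub, Matrix.sub_mul, Matrix.mul_one, mul_eq_one_comm.1 hB, Matrix.mul_smul,
    Matrix.smul_mul, mul_vecMulVec, vecMulVec_mul, star_mulVec]

lemma refl_conjTranspose (ζ : ℂ) (w : Bits n → ℂ) : (refl ζ w)ᴴ = refl (star ζ) w := by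
  ext x y
  simp only [refl, conjTranspose_apply, Matrix.sub_apply, Matrix.smul_apply, vecMulVec_apply,
    Pi.star_apply, smul_eq_mul, star_sub, star_mul', star_one, star_star, Matrix.one_apply]
  rw [mul_comm (star (w y))]
  simp only [eq_comm (a := y) (b := x)]
  congr 1
  split_ifs <;> simp

lemma refl_mul_refl {w : Bits n → ℂ} (hw : star w ⬝ᵥ w = 1) (ζ ξ : ℂ) :
    refl ζ w * refl ξ w = refl (ζ * ξ) w := by
  refine op_ext fun φ x => ?_
  rw [← mulVec_mulVec, refl_mulVec, refl_mulVec, refl_mulVec, dotProduct_sub, dotProduct_smul, hw]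
  simp only [Pi.sub_apply, Pi.smul_apply, smul_eq_mul]
  ring

lemma refl_one (w : Bits n → ℂ) : refl 1 w = 1 := by simp [refl]

/-- All reflections of order dividing eight along `w` are implementable with one ancilla and at
most `L` gates. -/
def ReflSynth (w : Bits n → ℂ) (L : ℕ) : Prop := ∀ k : ℕ, Synth (refl (omega ^ k) w) L

namespace ReflSynth

lemma mono {w : Bits n → ℂ} {L L' : ℕ} (h : ReflSynth w L) (hL : L ≤ L') : ReflSynth w L' :=
  fun k => (h k).mono hL

lemma mulVec {B : Op n} {w : Bits n → ℂ} {c L : ℕ} (hB : SynthUnitary B c) (hw : ReflSynth w L) :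
    ReflSynth (B *ᵥ w) (L + 2 * c) := by
  intro k
  rw [refl_conj hB.1]
  exact ((hB.2.1.mul (hw k)).mul hB.2.2).mono (by omega)

lemma of_mulVec {B : Op n} {w : Bits n → ℂ} {c L : ℕ} (hB : SynthUnitary B c)
    (hw : ReflSynth (B *ᵥ w) L) : ReflSynth w (L + 2 * c) := by
  have h := hw.mulVec hB.conjTranspose
  rwa [mulVec_mulVec, hB.1, one_mulVec] at h

/-- The inverse of a reflection with eigenvalue ω^k has eigenvalue ω^(7k); this is why `ReflSynth`
asks for all powers of ω at once. -/
lemma synthUnitary {w : Bits n → ℂ} {L : ℕ} (hw : ReflSynth w L) (h1 : star w ⬝ᵥ w = 1) (k : ℕ) :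
    SynthUnitary (refl (omega ^ k) w) L := by
  have hs : star (omega ^ k) = omega ^ (7 * k) := by rw [star_pow, star_omega, pow_mul]
  refine ⟨?_, hw k, ?_⟩
  · rw [refl_conjTranspose, refl_mul_refl h1, star_pow, ← mul_pow, star_omega_mul, one_pow,
      refl_one]
  · rw [refl_conjTranspose, hs]
    exact hw _

end ReflSynth

/-! ### Reflections along basis states and two-level Hadamard gates. -/

/-- A computational basis state. -/
def ket (x : Bits n) : Bits n → ℂ := Pi.single x 1

lemma star_ket_dotProduct (x : Bits n) (φ : Bits n → ℂ) : star (ket x) ⬝ᵥ φ = φ x := by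
  rw [ket, Pi.star_single, star_one, single_one_dotProduct]

lemma onQubit_ket (A : Matrix (Fin 2) (Fin 2) ℂ) (q : Fin n) (y : Bits n) :
    onQubit A q *ᵥ ket y =
      A 0 (y q) • ket (update y q 0) + A 1 (y q) • ket (update y q 1) := by
  ext x
  have h01 : x q = 0 ∨ x q = 1 := by generalize x q = a; revert a; decide
  rw [ket, mulVec_single_one]
  simp only [Matrix.col_apply, onQubit, Matrix.of_apply, Pi.add_apply, Pi.smul_apply, ket,
    Pi.single_apply, smul_eq_mul]
  split_ifs with h h' h'' h''
  · have e := congrFun h' q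
    have e' := congrFun h'' q
    simp [e] at e'
  · have e := congrFun h' q
    simp only [update_self] at e
    rw [e]; simp
  · have e := congrFun h'' q
    simp only [update_self] at e
    rw [e]; simp
  · have e := eq_update_of_agree (fun j hj => (h j hj).symm)
    rcases h01 with h01 | h01 <;> rw [h01] at e <;> contradiction
  · exact (h fun j hj => by simp_all).elim
  · exact (h fun j hj => by simp_all).elim
  · exact (h fun j hj => by simp_all).elim
  · simp

lemma pauliX_ket (q : Fin n) (y : Bits n) :
    onQubit pauliX q *ᵥ ket y = ket (update y q (y q + 1)) := by
  have h01 : y q = 0 ∨ y q = 1 := by generalize y q = a; revert a; decide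
  have h11 : (1 : Fin 2) + 1 = 0 := by decide
  rw [onQubit_ket]
  rcases h01 with h | h <;> simp [h, pauliX, h11]

lemma cnotOp_ket (c t : Fin n) (y : Bits n) :
    cnotOp c t *ᵥ ket y = ket (update y t (y t + y c)) := by
  ext x
  rw [ket, mulVec_single_one]
  simp [cnotOp, ket, Pi.single_apply]

lemma reflSynth_ket_one (hn : 2 ≤ n) : ReflSynth (ket (1 : Bits n)) (592 * n + 50) := by
  intro k
  obtain ⟨C, hC, h⟩ := exists_phase_ones n hn k
  refine ⟨C, fun ψ => ?_, hC⟩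
  rw [h]
  congr 1
  ext x
  rw [refl_mulVec, star_ket_dotProduct]
  by_cases hx : x = 1
  · subst hx; simp [ket]; ring
  · simp [ket, hx]

lemma reflSynth_ket (hn : 2 ≤ n) (x : Bits n) : ReflSynth (ket x) (648 * n + 50) := by
  -- Here `k` counts the zeros of `x`; conjugation by an X gate turns one of them into a one at cost
  -- 2 · 28 = 56.
  suffices h : ∀ (k : ℕ) (x : Bits n), (Finset.univ.filter fun q => x q = 0).card = k →
      ReflSynth (ket x) (592 * n + 50 + 56 * k) by
    refine (h _ x rfl).mono ?_
    have := (Finset.univ.filter fun q => x q = 0).card_le_univ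
    rw [Fintype.card_fin] at this
    omega
  intro k
  induction k with
  | zero =>
    intro x hx
    have : x = 1 := by
      ext1 q
      have h0 : x q ≠ 0 := by
        rw [Finset.card_eq_zero, Finset.filter_eq_empty_iff] at hx
        exact hx (Finset.mem_univ q)
      have h01 : ∀ a : Fin 2, a = 0 ∨ a = 1 := by decide
      exact (h01 _).resolve_left h0
    subst this
    exact reflSynth_ket_one hn
  | succ k ih =>
    intro x hx
    obtain ⟨q, hq⟩ : (Finset.univ.filter fun q => x q = 0).Nonempty := by
      rw [← Finset.card_pos]; omega
    have hq0 : x q = 0 := (Finset.mem_filter.1 hq).2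
    have he : (Finset.univ.filter fun r => update x q 1 r = 0) =
        (Finset.univ.filter fun r => x r = 0).erase q := by
      ext r
      by_cases hr : r = q
      · subst hr; simp
      · simp [hr]
    have h := (ih (update x q 1) (by rw [he, Finset.card_erase_of_mem hq, hx]; rfl)).mulVec
      (synthUnitary_pauliX q)
    have h11 : (1 : Fin 2) + 1 = 0 := by decide
    rw [pauliX_ket, update_self, update_idem, h11, ← hq0, update_eq_self] at h
    exact h.mono (by omega)

/-- The vector whose reflection is the Hadamard gate on the plane of two basis states. -/
noncomputable def hadamardVec (x y : Bits n) : Bits n → ℂ :=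
  diagHadamard 0 1 • ket x + diagHadamard 1 1 • ket y

lemma reflSynth_hadamardVec_adjacent (hn : 2 ≤ n) (y : Bits n) (q : Fin n) :
    ReflSynth (hadamardVec (update y q (y q + 1)) y) (648 * n + 162) := by
  have h01 : ∀ a : Fin 2, a = 0 ∨ a = 1 := by decide
  have h11 : (1 : Fin 2) + 1 = 0 := by decide
  have key : ∀ y : Bits n, y q = 1 →
      ReflSynth (hadamardVec (update y q (y q + 1)) y) (648 * n + 106) := by
    intro y hy
    have h := (reflSynth_ket hn y).mulVec (synthUnitary_diagHadamard q)
    rw [onQubit_ket, hy] at h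
    nth_rewrite 4 [← hy] at h
    rw [update_eq_self] at h
    rw [hy, h11]
    exact h.mono (by omega)
  rcases h01 (y q) with hy | hy
  · have h := (key (update y q 1) (update_self ..)).mulVec (synthUnitary_pauliX q)
    rw [hadamardVec, mulVec_add, mulVec_smul, mulVec_smul, pauliX_ket, pauliX_ket] at h
    simp only [update_self, update_idem, h11, zero_add] at h
    nth_rewrite 2 [← hy] at h
    rw [update_eq_self] at h
    rw [hy, zero_add]
    exact h
  · exact (key y hy).mono (by omega)

/-- The strings differ at `q`, so a CNOT with control `q` removes any other disagreement between
them, at cost 2 · 7 = 14. What remains is a pair of strings that differ at `q` alone. -/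
lemma reflSynth_hadamardVec (hn : 2 ≤ n) {x y : Bits n} (hxy : x ≠ y) :
    ReflSynth (hadamardVec x y) (662 * n + 162) := by
  obtain ⟨q, hq⟩ := Function.ne_iff.1 hxy
  suffices h : ∀ (k : ℕ) (x y : Bits n), x q ≠ y q →
      (Finset.univ.filter fun r => r ≠ q ∧ x r ≠ y r).card = k →
      ReflSynth (hadamardVec x y) (648 * n + 162 + 14 * k) by
    refine (h _ x y hq rfl).mono ?_
    have := (Finset.univ.filter fun r => r ≠ q ∧ x r ≠ y r).card_le_univ
    rw [Fintype.card_fin] at this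
    omega
  clear hq hxy x y
  have hne : ∀ a b : Fin 2, a ≠ b → a = b + 1 := by decide
  intro k
  induction k with
  | zero =>
    intro x y hq hk
    have : x = update y q (y q + 1) := by
      ext1 r
      by_cases hr : r = q
      · subst hr; rw [update_self, hne _ _ hq]
      · rw [Finset.card_eq_zero, Finset.filter_eq_empty_iff] at hk
        have := hk (Finset.mem_univ r)
        rw [update_of_ne hr]
        by_contra h
        exact this ⟨hr, h⟩
    rw [this]
    exact reflSynth_hadamardVec_adjacent hn y q
  | succ k ih =>
    intro x y hq hk
    obtain ⟨r, hr⟩ : (Finset.univ.filter fun r => r ≠ q ∧ x r ≠ y r).Nonempty := by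
      rw [← Finset.card_pos]; omega
    obtain ⟨hrq, hxy⟩ := (Finset.mem_filter.1 hr).2
    have key : ∀ a b : Fin 2, a + b + b = a := by decide
    have key2 : ∀ a b c d : Fin 2, a ≠ b → c ≠ d → a + c = b + d := by decide
    have he : (Finset.univ.filter fun s => s ≠ q ∧
        update x r (x r + x q) s ≠ update y r (y r + y q) s) =
        (Finset.univ.filter fun r => r ≠ q ∧ x r ≠ y r).erase r := by
      ext s
      by_cases hs : s = r
      · subst hs; simp [key2 _ _ _ _ hxy hq]
      · simp [hs]
    have h := (ih (update x r (x r + x q)) (update y r (y r + y q))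
      (by simpa [hrq.symm] using hq)
      (by rw [he, Finset.card_erase_of_mem hr, hk]; rfl)).mulVec (synthUnitary_cnotOp hrq.symm)
    rw [hadamardVec, mulVec_add, mulVec_smul, mulVec_smul, cnotOp_ket,
      cnotOp_ket] at h
    simp only [update_self, update_idem, update_of_ne hrq.symm, key, update_eq_self] at h
    exact h.mono (by omega)

/-- For w the second column, these are the entries of ww*; they say that 1 − 2ww* is the Hadamard
matrix. -/
lemma diagHadamard_norms :
    star (diagHadamard 0 1) * diagHadamard 0 1 = (1 - sqrtTwo⁻¹) / 2 ∧
    star (diagHadamard 1 1) * diagHadamard 1 1 = (1 + sqrtTwo⁻¹) / 2 ∧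
    star (diagHadamard 0 1) * diagHadamard 1 1 = -sqrtTwo⁻¹ / 2 ∧
    star (diagHadamard 1 1) * diagHadamard 0 1 = -sqrtTwo⁻¹ / 2 := by
  have hinv : sqrtTwo⁻¹ = (omega - omega ^ 3) / 2 := by
    rw [← sqrtTwo_eq]
    have := sqrtTwo_sq
    field_simp [sqrtTwo_ne_zero]
    linear_combination -this
  have h4 := omega_pow_four
  have hI : Complex.I = omega ^ 2 := omega_sq.symm
  have hs : star omega = -omega ^ 3 := by
    rw [star_omega]; linear_combination omega ^ 3 * h4
  rw [diagHadamard_zero_one, diagHadamard_one_one, hinv]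
  have h2 : star (2 : ℂ) = 2 := by simp
  simp only [star_div₀, star_sub, star_mul', star_add, star_one, star_pow, hs, hI, h2]
  refine ⟨?_, ?_, ?_, ?_⟩
  · linear_combination -1 / 4 * h4
  · linear_combination ((omega ^ 4 - 1) * (1 + omega - omega ^ 3 - omega ^ 4) - 1) / 4 * h4
  · linear_combination (omega + omega ^ 2) / 4 * h4
  · linear_combination (omega ^ 6 - omega ^ 3 - omega * (omega ^ 4 - 1)) / 4 * h4

lemma star_hadamardVec_dotProduct (x y : Bits n) (φ : Bits n → ℂ) :
    star (hadamardVec x y) ⬝ᵥ φ =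
      star (diagHadamard 0 1) * φ x + star (diagHadamard 1 1) * φ y := by
  rw [hadamardVec, star_add, star_smul, star_smul, add_dotProduct, smul_dotProduct,
    smul_dotProduct, star_ket_dotProduct, star_ket_dotProduct]
  rfl

lemma hadamardVec_unit {x y : Bits n} (hxy : x ≠ y) :
    star (hadamardVec x y) ⬝ᵥ hadamardVec x y = 1 := by
  obtain ⟨h1, h2, -, -⟩ := diagHadamard_norms
  rw [star_hadamardVec_dotProduct]
  simp only [hadamardVec, ket, Pi.add_apply, Pi.smul_apply, Pi.single_eq_same, smul_eq_mul,
    Pi.single_eq_of_ne hxy, Pi.single_eq_of_ne hxy.symm, mul_one, mul_zero, add_zero, zero_add]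
  linear_combination h1 + h2

/-- The Hadamard gate on the plane of the basis states `x` and `y`, after the phase `omega ^ k`
on `y`. -/
noncomputable def twoLevel (x y : Bits n) (k : ℕ) : Op n :=
  refl (omega ^ 4) (hadamardVec x y) * refl (omega ^ k) (ket y)

lemma synthUnitary_twoLevel (hn : 2 ≤ n) {x y : Bits n} (hxy : x ≠ y) (k : ℕ) :
    SynthUnitary (twoLevel x y k) (1310 * n + 212) :=
  (((reflSynth_hadamardVec hn hxy).synthUnitary (hadamardVec_unit hxy) 4).mul
    ((reflSynth_ket hn y).synthUnitary (by rw [star_ket_dotProduct]; simp [ket]) k)).mono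
    (by omega)

lemma twoLevel_mulVec {x y : Bits n} (hxy : x ≠ y) (k : ℕ) (φ : Bits n → ℂ) :
    twoLevel x y k *ᵥ φ =
      update (update φ x (sqrtTwo⁻¹ * (φ x + omega ^ k * φ y))) y
        (sqrtTwo⁻¹ * (φ x - omega ^ k * φ y)) := by
  obtain ⟨h1, h2, h3, h4⟩ := diagHadamard_norms
  rw [twoLevel, ← mulVec_mulVec]
  have hφ : refl (omega ^ k) (ket y) *ᵥ φ = update φ y (omega ^ k * φ y) := by
    rw [refl_mulVec, star_ket_dotProduct]
    ext z
    by_cases hz : z = y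
    · subst hz; simp [ket]; ring
    · simp [ket, hz]
  rw [hφ, refl_mulVec, star_hadamardVec_dotProduct, omega_pow_four]
  ext z
  simp only [hadamardVec, Pi.sub_apply, Pi.smul_apply, Pi.add_apply, smul_eq_mul, update_self,
    update_of_ne hxy, ket]
  by_cases hzy : z = y
  · subst hzy
    simp only [update_self, Pi.single_eq_same, Pi.single_eq_of_ne hxy.symm]
    linear_combination (-2 * φ x) * h3 - 2 * (omega ^ k * φ z) * h2
  · by_cases hzx : z = x
    · subst hzx
      simp only [update_self, update_of_ne hxy, Pi.single_eq_same, Pi.single_eq_of_ne hxy]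
      linear_combination (-2 * φ z) * h1 - 2 * (omega ^ k * φ y) * h4
    · simp [hzy, hzx]

/-! ### The ring ℤ[ω] modulo 2: weights and norms. -/

/-- The integer of the eighth cyclotomic field with the given coordinates with respect to the
powers of `omega`. -/
structure OctInt where
  a : ℤ
  b : ℤ
  c : ℤ
  d : ℤ

/-- The parity of an integer, as a Boolean. -/
def parity (a : ℤ) : Bool := decide (a % 2 = 1)

lemma parity_add (a b : ℤ) : parity (a + b) = (parity a ^^ parity b) := by
  unfold parity
  rcases Int.emod_two_eq_zero_or_one a with h | h <;>
    rcases Int.emod_two_eq_zero_or_one b with h' | h' <;> simp [Int.add_emod, h, h']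

lemma parity_mul (a b : ℤ) : parity (a * b) = (parity a && parity b) := by
  unfold parity
  rcases Int.emod_two_eq_zero_or_one a with h | h <;>
    rcases Int.emod_two_eq_zero_or_one b with h' | h' <;> simp [Int.mul_emod, h, h']

lemma parity_neg (a : ℤ) : parity (-a) = parity a := by
  unfold parity
  congr 1
  exact propext (by omega)

lemma parity_sub (a b : ℤ) : parity (a - b) = (parity a ^^ parity b) := by
  rw [sub_eq_add_neg, parity_add, parity_neg]

lemma parity_sq (a : ℤ) : parity (a ^ 2) = parity a := by
  rw [sq, parity_mul, Bool.and_self]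

lemma parity_eq_false_iff (a : ℤ) : parity a = false ↔ 2 ∣ a := by
  unfold parity
  rw [decide_eq_false_iff_not]
  omega

/-- The weight of a residue class modulo two. -/
def parityWeight (p : Bool × Bool × Bool × Bool) : ℕ :=
  if p.1 ^^ p.2.1 ^^ p.2.2.1 ^^ p.2.2.2 then 2 else if p.1 ^^ p.2.2.1 then 1 else 0

/-- Multiplication by `omega` modulo two. -/
def parityRotate (p : Bool × Bool × Bool × Bool) : Bool × Bool × Bool × Bool :=
  (p.2.2.2, p.1, p.2.1, p.2.2.1)

/-- Let p be the prime above 2, so that p⁴ = (2) and p² = (√2). Modulo p³ the units form a group of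
order 4 generated by ω, so after removing the common valuation 0 or 1, x ≡ ω^k y mod p³ for some k.
Then x ± ω^k y is divisible by √2 and the quotient has larger valuation than x. Signs vanish modulo
2, so four values of k suffice, and sum and difference behave alike. -/
lemma exists_parityRotate : ∀ a b c d a' b' c' d' : Bool,
    parityWeight (a, b, c, d) = parityWeight (a', b', c', d') → parityWeight (a, b, c, d) ≠ 0 →
    ∃ k : Fin 4, let r := parityRotate^[k] (a', b', c', d')
      (a ^^ r.1) = (c ^^ r.2.2.1) ∧ (b ^^ r.2.1) = (d ^^ r.2.2.2) ∧
      (if (b ^^ r.2.1) ^^ (c ^^ r.2.2.1) then 2 else if b ^^ r.2.1 then 1 else 0) <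
        parityWeight (a, b, c, d) := by
  decide

namespace OctInt

/-- The complex number that an element of `OctInt` stands for. -/
noncomputable def toComplex (x : OctInt) : ℂ :=
  x.a + x.b * omega + x.c * omega ^ 2 + x.d * omega ^ 3

/-- The parities of the coordinates. -/
def parities (x : OctInt) : Bool × Bool × Bool × Bool :=
  (parity x.a, parity x.b, parity x.c, parity x.d)

/-- The weight of `x` is 2, 1 or 0 when the valuation of `x` at the prime above two is 0, 1 or
at least 2. -/
def weight (x : OctInt) : ℕ := parityWeight x.parities

lemma weight_le_two (x : OctInt) : x.weight ≤ 2 := by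
  unfold weight parityWeight
  split_ifs <;> norm_num

/-- Multiplication by `omega`. -/
def mulOmega (x : OctInt) : OctInt := ⟨-x.d, x.a, x.b, x.c⟩

lemma toComplex_mulOmega_iterate (k : ℕ) (x : OctInt) :
    (mulOmega^[k] x).toComplex = omega ^ k * x.toComplex := by
  induction k with
  | zero => simp
  | succ k ih =>
    rw [iterate_succ_apply', pow_succ', mul_assoc, ← ih]
    simp only [toComplex, mulOmega]
    push_cast
    linear_combination -((mulOmega^[k] x).d : ℂ) * omega_pow_four

lemma parities_mulOmega_iterate (k : ℕ) (x : OctInt) :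
    (mulOmega^[k] x).parities = parityRotate^[k] x.parities := by
  induction k with
  | zero => simp
  | succ k ih =>
    rw [iterate_succ_apply', iterate_succ_apply', ← ih]
    simp [parities, mulOmega, parityRotate, parity_neg]

lemma exists_div_sqrtTwo (z : OctInt) (h : parity z.a = parity z.c) (h' : parity z.b = parity z.d) :
    ∃ x : OctInt, x.toComplex = sqrtTwo⁻¹ * z.toComplex ∧
      x.weight = if parity z.b ^^ parity z.c then 2 else if parity z.b then 1 else 0 := by
  have h1 : 2 ∣ z.a + z.c := by rw [← parity_eq_false_iff, parity_add, h, Bool.xor_self]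
  have h2 : 2 ∣ z.b + z.d := by rw [← parity_eq_false_iff, parity_add, h', Bool.xor_self]
  obtain ⟨e, he⟩ := h1
  obtain ⟨f, hf⟩ := h2
  -- The quotient is √2 · z / 2, and √2 = ω − ω³ gives √2 · z the coordinates (b − d, a + c, b + d,
  -- c − a).
  refine ⟨⟨z.b - f, e, f, z.c - e⟩, ?_, ?_⟩
  · have ha : (z.a : ℂ) = 2 * e - z.c := by rw [eq_sub_iff_add_eq]; exact_mod_cast he
    have hd : (z.d : ℂ) = 2 * f - z.b := by rw [eq_sub_iff_add_eq, add_comm]; exact_mod_cast hf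
    rw [eq_inv_mul_iff_mul_eq₀ sqrtTwo_ne_zero]
    simp only [toComplex]
    rw [sqrtTwo_eq, ha, hd]
    push_cast
    linear_combination (-(z.c : ℂ) * omega ^ 2 + e * omega ^ 2 - f * omega + z.c - e - e) *
      omega_pow_four
  · simp only [weight, parityWeight, parities, parity_sub]
    congr 2
    · generalize parity z.b = b; generalize parity f = f'; generalize parity e = e'
      generalize parity z.c = c; revert b c e' f'; decide
    · congr 1
      generalize parity z.b = b; generalize parity f = f'; revert b f'; decide

lemma exists_hadamard_step (x y : OctInt) (h : x.weight = y.weight) (h0 : x.weight ≠ 0) :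
    ∃ (k : ℕ) (x' y' : OctInt),
      x'.toComplex = sqrtTwo⁻¹ * (x.toComplex + omega ^ k * y.toComplex) ∧
      y'.toComplex = sqrtTwo⁻¹ * (x.toComplex - omega ^ k * y.toComplex) ∧
      x'.weight < x.weight ∧ y'.weight < y.weight := by
  obtain ⟨k, h1, h2, h3⟩ := exists_parityRotate _ _ _ _ _ _ _ _ h h0
  change _ < x.weight at h3
  have hr := parities_mulOmega_iterate k y
  have hc := toComplex_mulOmega_iterate k y
  rw [show (parity y.a, parity y.b, parity y.c, parity y.d) = y.parities from rfl, ← hr] at h1 h2 h3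
  generalize mulOmega^[k] y = u at *
  simp only [parities] at h1 h2 h3
  obtain ⟨x', hx', hwx⟩ := exists_div_sqrtTwo ⟨x.a + u.a, x.b + u.b, x.c + u.c, x.d + u.d⟩
    (by simpa [parity_add] using h1) (by simpa [parity_add] using h2)
  obtain ⟨y', hy', hwy⟩ := exists_div_sqrtTwo ⟨x.a - u.a, x.b - u.b, x.c - u.c, x.d - u.d⟩
    (by simpa [parity_sub] using h1) (by simpa [parity_sub] using h2)
  simp only [parity_add, parity_sub] at hwx hwy
  refine ⟨k, x', y', ?_, ?_, by rw [hwx]; exact h3, by rw [hwy, ← h]; exact h3⟩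
  · rw [hx', ← hc]; simp only [toComplex]; push_cast; ring
  · rw [hy', ← hc]; simp only [toComplex]; push_cast; ring

/-- The rational part of the squared absolute value. -/
def normA (x : OctInt) : ℤ := x.a ^ 2 + x.b ^ 2 + x.c ^ 2 + x.d ^ 2

/-- The coefficient of `√2` in the squared absolute value. -/
def normB (x : OctInt) : ℤ := x.a * x.b + x.b * x.c + x.c * x.d - x.d * x.a

lemma star_toComplex_mul (x : OctInt) :
    star x.toComplex * x.toComplex = x.normA + x.normB * sqrtTwo := by
  have h4 := omega_pow_four
  have hs : star omega = -omega ^ 3 := by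
    rw [star_omega]; linear_combination omega ^ 3 * h4
  have hz : ∀ z : ℤ, star (z : ℂ) = z := fun z => by simp
  simp only [toComplex, normA, normB, star_add, star_mul', star_pow, hs, hz, sqrtTwo_eq]
  push_cast
  have h5 : omega ^ 5 = -omega := by linear_combination omega * h4
  have h6 : omega ^ 6 = -omega ^ 2 := by linear_combination omega ^ 2 * h4
  have h7 : omega ^ 7 = -omega ^ 3 := by linear_combination omega ^ 3 * h4
  have h8 : omega ^ 8 = 1 := omega_pow_eight
  have h9 : omega ^ 9 = omega := by linear_combination omega * h8
  have h10 : omega ^ 10 = omega ^ 2 := by linear_combination omega ^ 2 * h8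
  have h11 : omega ^ 11 = omega ^ 3 := by linear_combination omega ^ 3 * h8
  have h12 : omega ^ 12 = -1 := by linear_combination omega ^ 4 * h8 + h4
  ring_nf
  simp only [h4, h5, h6, h7, h8, h9, h10, h11, h12]
  ring

lemma weight_eq_two_iff (x : OctInt) : x.weight = 2 ↔ parity x.normA = true := by
  have key : ∀ a b c d : Bool, parityWeight (a, b, c, d) = 2 ↔ (a ^^ b ^^ c ^^ d) = true := by
    decide
  rw [weight, parities, key]
  simp only [normA, parity_add, parity_sq, Bool.xor_assoc]

/-- Modulo 2, `normB` is (a + c)(b + d), which is odd exactly when a + c and b + d are both odd. -/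
lemma weight_eq_one_iff (x : OctInt) : x.weight = 1 ↔ parity x.normB = true := by
  have key : ∀ a b c d : Bool, parityWeight (a, b, c, d) = 1 ↔
      ((((a && b) ^^ (b && c)) ^^ (c && d)) ^^ (d && a)) = true := by
    decide
  rw [weight, parities, key]
  simp only [normB, parity_add, parity_mul, parity_sub]

lemma toComplex_eq_zero_of_normA {x : OctInt} (h : x.normA = 0) : x.toComplex = 0 := by
  unfold normA at h
  have ha : x.a = 0 := by nlinarith [sq_nonneg x.a, sq_nonneg x.b, sq_nonneg x.c, sq_nonneg x.d]
  have hb : x.b = 0 := by nlinarith [sq_nonneg x.a, sq_nonneg x.b, sq_nonneg x.c, sq_nonneg x.d]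
  have hc : x.c = 0 := by nlinarith [sq_nonneg x.a, sq_nonneg x.b, sq_nonneg x.c, sq_nonneg x.d]
  have hd : x.d = 0 := by nlinarith [sq_nonneg x.a, sq_nonneg x.b, sq_nonneg x.c, sq_nonneg x.d]
  simp [toComplex, ha, hb, hc, hd]

lemma normA_nonneg (x : OctInt) : 0 ≤ x.normA := by unfold normA; positivity

end OctInt

lemma eq_of_add_mul_sqrtTwo {A B C : ℤ} (h : (A : ℂ) + B * sqrtTwo = C) : A = C ∧ B = 0 := by
  have h' : (A : ℝ) + B * Real.sqrt 2 = C := by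
    unfold sqrtTwo at h
    exact_mod_cast h
  have hB : B = 0 := by
    by_contra hB
    have hB' : (B : ℝ) ≠ 0 := by exact_mod_cast hB
    refine irrational_sqrt_two ⟨(C - A : ℤ) / (B : ℤ), ?_⟩
    push_cast
    rw [div_eq_iff hB']
    linarith
  subst hB
  exact ⟨by simpa using h', rfl⟩

lemma exists_ne_parity_true {ι : Type*} [Fintype ι] [DecidableEq ι] (f : ι → ℤ)
    (hf : 2 ∣ ∑ i, f i) {i : ι} (hi : parity (f i) = true) :
    ∃ j, j ≠ i ∧ parity (f j) = true := by
  by_contra! h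
  have h1 : 2 ∣ ∑ j ∈ Finset.univ.erase i, f j := Finset.dvd_sum fun j hj => by
    rw [← parity_eq_false_iff]
    simpa using h j (Finset.ne_of_mem_erase hj)
  rw [← Finset.add_sum_erase _ _ (Finset.mem_univ i)] at hf
  rw [(parity_eq_false_iff _).2 ((dvd_add_left h1).1 hf)] at hi
  exact Bool.noConfusion hi

/-! ### Reduction of a unit vector to a basis state. -/

lemma sum_norms_of_unit {k : ℕ} {v : Bits n → OctInt} {φ : Bits n → ℂ}
    (hφ : ∀ z, φ z = (v z).toComplex / sqrtTwo ^ k) (h : star φ ⬝ᵥ φ = 1) :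
    ∑ z, (v z).normA = 2 ^ k ∧ ∑ z, (v z).normB = 0 := by
  apply eq_of_add_mul_sqrtTwo
  have hs : sqrtTwo ^ k * sqrtTwo ^ k = 2 ^ k := by rw [← mul_pow, ← sq, sqrtTwo_sq]
  have h0 : sqrtTwo ^ k ≠ 0 := pow_ne_zero _ sqrtTwo_ne_zero
  have hz : ∀ z, ((v z).normA : ℂ) + (v z).normB * sqrtTwo = 2 ^ k * (star (φ z) * φ z) := by
    intro z
    rw [← OctInt.star_toComplex_mul, hφ, star_div₀, star_pow, star_sqrtTwo, ← hs]
    field_simp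
  push_cast
  rw [Finset.sum_mul, ← Finset.sum_add_distrib, Finset.sum_congr rfl fun z _ => hz z,
    ← Finset.mul_sum]
  have : ∑ z, star (φ z) * φ z = 1 := h
  rw [this, mul_one]

lemma dotProduct_mulVec_of_unitary {B : Op n} (hB : Bᴴ * B = 1) (φ : Bits n → ℂ) :
    star (B *ᵥ φ) ⬝ᵥ (B *ᵥ φ) = star φ ⬝ᵥ φ := by
  rw [star_mulVec, ← dotProduct_mulVec, mulVec_mulVec, hB, one_mulVec]

/-- Both sums are even, so evenly many entries have odd `normA` (weight 2) and evenly many have odd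
`normB` (weight 1). The exponent k + 1 is what makes the first sum even. -/
lemma exists_ne_weight_eq {k : ℕ} {v : Bits n → OctInt} (hA : ∑ z, (v z).normA = 2 ^ (k + 1))
    (hB : ∑ z, (v z).normB = 0) {x : Bits n} (hx : (v x).weight ≠ 0) :
    ∃ y, y ≠ x ∧ (v y).weight = (v x).weight := by
  have h2 := (v x).weight_le_two
  obtain h | h : (v x).weight = 2 ∨ (v x).weight = 1 := by omega
  · obtain ⟨y, hy, h'⟩ := exists_ne_parity_true (fun z => (v z).normA)
      (by rw [hA, pow_succ]; exact dvd_mul_left _ _) (((v x).weight_eq_two_iff).1 h)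
    exact ⟨y, hy, by rw [h, (v y).weight_eq_two_iff]; exact h'⟩
  · obtain ⟨y, hy, h'⟩ := exists_ne_parity_true (fun z => (v z).normB)
      (by rw [hB]; exact dvd_zero _) (((v x).weight_eq_one_iff).1 h)
    exact ⟨y, hy, by rw [h, (v y).weight_eq_one_iff]; exact h'⟩

/-- A unit vector with one nonzero entry is a basis state up to a phase. -/
lemma exists_eq_smul_ket {v : Bits n → OctInt} (hA : ∑ z, (v z).normA = 1) {φ : Bits n → ℂ}
    (hφ : ∀ z, φ z = (v z).toComplex) (h : star φ ⬝ᵥ φ = 1) :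
    ∃ (c : ℂ) (x : Bits n), c * star c = 1 ∧ φ = c • ket x := by
  -- Nonnegative integers with sum 1 have exactly one nonzero term.
  obtain ⟨x, -, hx⟩ : ∃ x ∈ Finset.univ, (v x).normA ≠ 0 := by
    apply Finset.exists_ne_zero_of_sum_ne_zero
    rw [hA]; norm_num
  have h0 : ∀ y, y ≠ x → φ y = 0 := by
    intro y hy
    rw [hφ]
    apply OctInt.toComplex_eq_zero_of_normA
    rw [← Finset.add_sum_erase _ _ (Finset.mem_univ x)] at hA
    have hs := Finset.single_le_sum (f := fun z => (v z).normA)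
      (fun z _ => (v z).normA_nonneg) (Finset.mem_erase.2 ⟨hy, Finset.mem_univ y⟩)
    have h1 := (v x).normA_nonneg
    have h2 := (v y).normA_nonneg
    omega
  have he : φ = φ x • ket x := by
    ext z
    by_cases hz : z = x
    · subst hz; simp [ket]
    · simp [ket, hz, h0 z hz]
  refine ⟨φ x, x, ?_, he⟩
  have : ∑ z, star (φ z) * φ z = 1 := h
  rw [Finset.sum_eq_single x] at this
  · rw [mul_comm]; exact this
  · intro y _ hy; rw [h0 y hy, mul_zero]
  · simp

/-- The reflection along a unit vector with entries in `ℤ[omega] / √2 ^ k`, by reducing the vector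
to a basis state. -/
theorem reflSynth_of_octInt (hn : 2 ≤ n) (k : ℕ) : ∀ (v : Bits n → OctInt) (φ : Bits n → ℂ),
    (∀ z, φ z = (v z).toComplex / sqrtTwo ^ k) → star φ ⬝ᵥ φ = 1 →
    ReflSynth φ (648 * n + 50 +
      (k * (2 * 2 ^ n) + ∑ z, (v z).weight) * (2 * (1310 * n + 212))) := by
  induction k with
  | zero =>
    intro v φ hφ h1
    obtain ⟨hA, -⟩ := sum_norms_of_unit hφ h1
    obtain ⟨c, x, hc, rfl⟩ := exists_eq_smul_ket hA (by simpa using hφ) h1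
    intro m
    rw [refl_smul hc]
    exact (reflSynth_ket hn x m).mono (Nat.le_add_right _ _)
  | succ k ih =>
    intro v φ hφ h1
    -- For a fixed denominator exponent, the induction is on the total weight.
    induction hW : ∑ z, (v z).weight using Nat.strong_induction_on generalizing v φ with
    | _ W ihW =>
    by_cases hall : ∀ z, (v z).weight = 0
    -- Every entry is divisible by √2, so the exponent drops. The weights start afresh, each at most
    -- 2, which the term 2 · 2^n per unit of `k` pays for.
    · have hdiv : ∀ z, ∃ u : OctInt, u.toComplex = sqrtTwo⁻¹ * (v z).toComplex := by
        intro z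
        have hz := hall z
        have key : ∀ a b c d : Bool, parityWeight (a, b, c, d) = 0 → a = c ∧ b = d := by decide
        obtain ⟨h2, h3⟩ := key _ _ _ _ hz
        obtain ⟨u, hu, -⟩ := (v z).exists_div_sqrtTwo h2 h3
        exact ⟨u, hu⟩
      choose u hu using hdiv
      have h := ih u φ (fun z => by
        rw [hφ, hu, pow_succ]; field_simp) h1
      have hle : ∑ z, (u z).weight ≤ 2 * 2 ^ n := by
        calc ∑ z, (u z).weight ≤ ∑ _z : Bits n, 2 := Finset.sum_le_sum fun z _ =>
              (u z).weight_le_two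
          _ = 2 * 2 ^ n := by simp [mul_comm]
      refine h.mono (Nat.add_le_add_left (Nat.mul_le_mul_right _ ?_) _)
      rw [add_mul k 1, one_mul]
      omega
    · push Not at hall
      obtain ⟨x, hx⟩ := hall
      obtain ⟨hA, hB⟩ := sum_norms_of_unit hφ h1
      obtain ⟨y, hyx, hxy⟩ := exists_ne_weight_eq hA hB hx
      obtain ⟨m, x', y', hx', hy', hwx, hwy⟩ := OctInt.exists_hadamard_step (v x) (v y) hxy.symm hx
      have hU := synthUnitary_twoLevel hn hyx.symm m
      have hlt : ∑ z, (update (update v x x') y y' z).weight < W := by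
        rw [← hW]
        refine Finset.sum_lt_sum (fun z _ => ?_) ⟨y, Finset.mem_univ y, by simpa using hwy⟩
        by_cases hzy : z = y
        · subst hzy; simpa using hwy.le
        · by_cases hzx : z = x
          · subst hzx; simpa [hzy] using hwx.le
          · simp [hzy, hzx]
      have h := ihW _ hlt (update (update v x x') y y') (twoLevel x y m *ᵥ φ) (fun z => by
          rw [twoLevel_mulVec hyx.symm]
          by_cases hzy : z = y
          · subst hzy; simp only [update_self, hφ, hy']; ring
          · by_cases hzx : z = x
            · subst hzx; simp only [update_of_ne hzy, update_self, hφ, hx']; ring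
            · simp only [update_of_ne hzy, update_of_ne hzx, hφ])
        (by rw [dotProduct_mulVec_of_unitary hU.1, h1]) rfl
      -- The step costs two uses of the two-level gate, paid for by the drop of the total weight by
      -- at least 1.
      refine (ReflSynth.of_mulVec hU h).mono ?_
      generalize ∑ z, (update (update v x x') y y' z).weight = W' at hlt
      have : ((k + 1) * (2 * 2 ^ n) + W' + 1) * (2 * (1310 * n + 212)) ≤
          ((k + 1) * (2 * 2 ^ n) + W) * (2 * (1310 * n + 212)) :=
        Nat.mul_le_mul_right _ (by omega)
      rw [add_mul _ 1, one_mul] at this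
      linarith

/-! ### Embedding the unitary into a product of reflections. -/

lemma HasForm.exists_octInt {κ : ℕ} {z : ℂ} (h : HasForm κ z) :
    ∃ x : OctInt, z = x.toComplex / sqrtTwo ^ κ := by
  obtain ⟨a, b, c, d, rfl⟩ := h
  refine ⟨⟨a, b + d, c, d - b⟩, ?_⟩
  change (_ + _ * sqrtTwo + _ * (_ + _ * sqrtTwo)) / sqrtTwo ^ κ = _
  congr 1
  rw [sqrtTwo_eq, ← omega_sq, OctInt.toComplex]
  push_cast
  linear_combination -(d : ℂ) * omega * omega_pow_four

/-- Needed to write the entry 1 of the embedded vector over the same denominator √2^κ as the entries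
of `U`. -/
lemma exists_octInt_sqrtTwo_pow (κ : ℕ) : ∃ x : OctInt, x.toComplex = sqrtTwo ^ κ := by
  induction κ with
  | zero => exact ⟨⟨1, 0, 0, 0⟩, by simp [OctInt.toComplex]⟩
  | succ κ ih =>
    obtain ⟨x, hx⟩ := ih
    refine ⟨⟨x.b - x.d, x.a + x.c, x.b + x.d, x.c - x.a⟩, ?_⟩
    rw [pow_succ, ← hx, sqrtTwo_eq, OctInt.toComplex, OctInt.toComplex]
    push_cast
    linear_combination (x.b + x.c * omega + x.d * omega ^ 2 - x.d : ℂ) * omega_pow_four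

/-- The vector `(|j⟩ ⊗ |1⟩ - U |j⟩ ⊗ |0⟩) / √2`. -/
noncomputable def embedVec (U : Op n) (j : Bits n) : Bits (n + 1) → ℂ := fun z =>
  sqrtTwo⁻¹ * if z (Fin.last n) = 0 then -U (fun i => z i.castSucc) j
    else if (fun i => z i.castSucc) = j then 1 else 0

/-- The state `φ ⊗ |0⟩ + χ ⊗ |1⟩`. -/
def joinState (φ χ : Bits n → ℂ) : Bits (n + 1) → ℂ := fun z =>
  if z (Fin.last n) = 0 then φ (fun i => z i.castSucc) else χ (fun i => z i.castSucc)

lemma sum_bits_succ (f : Bits (n + 1) → ℂ) :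
    ∑ z, f z = ∑ x : Bits n, (f (Fin.snoc x 0 : Bits (n + 1)) + f (Fin.snoc x 1 : Bits (n + 1))) := by
  rw [← (Fin.snocEquiv (fun _ : Fin (n + 1) => Fin 2)).sum_comp, Fintype.sum_prod_type,
    Fin.sum_univ_two, ← Finset.sum_add_distrib]
  rfl

lemma joinState_dotProduct (φ χ φ' χ' : Bits n → ℂ) :
    star (joinState φ χ) ⬝ᵥ joinState φ' χ' = star φ ⬝ᵥ φ' + star χ ⬝ᵥ χ' := by
  simp only [dotProduct]
  rw [sum_bits_succ, Finset.sum_add_distrib]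
  simp [joinState]

lemma embedVec_eq (U : Op n) (j : Bits n) :
    embedVec U j = sqrtTwo⁻¹ • joinState (-(U *ᵥ ket j)) (ket j) := by
  ext z
  simp only [embedVec, joinState, Pi.smul_apply, smul_eq_mul, ket, mulVec_single_one,
    Pi.neg_apply, Matrix.col_apply, Pi.single_apply]

lemma ket_dotProduct_ket (i j : Bits n) : star (ket i) ⬝ᵥ ket j = if i = j then 1 else 0 := by
  rw [star_ket_dotProduct, ket, Pi.single_apply]

lemma unitary_ket_dotProduct {U : Op n} (hU : Uᴴ * U = 1) (i j : Bits n) :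
    star (U *ᵥ ket i) ⬝ᵥ (U *ᵥ ket j) = if i = j then 1 else 0 := by
  rw [star_mulVec, ← dotProduct_mulVec, mulVec_mulVec, hU, one_mulVec, ket_dotProduct_ket]

lemma star_smul_dotProduct_inv (φ χ : Bits n → ℂ) :
    star (sqrtTwo⁻¹ • φ) ⬝ᵥ χ = sqrtTwo⁻¹ * (star φ ⬝ᵥ χ) := by
  rw [star_smul, smul_dotProduct, star_inv₀, star_sqrtTwo, smul_eq_mul]

lemma embedVec_unit {U : Op n} (hU : Uᴴ * U = 1) (j : Bits n) :
    star (embedVec U j) ⬝ᵥ embedVec U j = 1 := by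
  rw [embedVec_eq, star_smul_dotProduct_inv, dotProduct_smul, joinState_dotProduct, star_neg,
    neg_dotProduct_neg, unitary_ket_dotProduct hU, ket_dotProduct_ket, if_pos rfl, smul_eq_mul]
  linear_combination 2 * sqrtTwo_inv_mul_inv

/-- As ω^4 = −1, this is an ordinary reflection, along the normalised difference of |i⟩|1⟩ and
U|i⟩|0⟩; it carries |i⟩|1⟩ to U|i⟩|0⟩ and fixes the other |j⟩|1⟩, which are orthogonal to that
difference. -/
lemma refl_embedVec (U : Op n) (i j : Bits n) :
    refl (omega ^ 4) (embedVec U i) *ᵥ joinState 0 (ket j) =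
      if i = j then joinState (U *ᵥ ket j) 0 else joinState 0 (ket j) := by
  rw [refl_mulVec, embedVec_eq, star_smul_dotProduct_inv, joinState_dotProduct,
    ket_dotProduct_ket, omega_pow_four, dotProduct_zero]
  split_ifs with h
  · subst h
    ext z
    simp only [Pi.sub_apply, Pi.smul_apply, smul_eq_mul, joinState, Pi.neg_apply, Pi.zero_apply]
    split_ifs
    · linear_combination 2 * (U *ᵥ ket i) (fun i => z i.castSucc) * sqrtTwo_inv_mul_inv
    · linear_combination -2 * (ket i) (fun i => z i.castSucc) * sqrtTwo_inv_mul_inv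
  · simp

/-- Orthogonality of the columns of `U` keeps a state that has already been moved from being
disturbed by later reflections. -/
lemma refl_embedVec_of_ne {U : Op n} (hU : Uᴴ * U = 1) {i j : Bits n} (h : i ≠ j) :
    refl (omega ^ 4) (embedVec U i) *ᵥ joinState (U *ᵥ ket j) 0 = joinState (U *ᵥ ket j) 0 := by
  rw [refl_mulVec, embedVec_eq, star_smul_dotProduct_inv, joinState_dotProduct, star_neg,
    neg_dotProduct, unitary_ket_dotProduct hU, if_neg h]
  simp

/-- The product of the reflections along the vectors `embedVec U j`. -/
noncomputable def reflProd (U : Op n) (l : List (Bits n)) : Op (n + 1) :=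
  (l.map fun j => refl (omega ^ 4) (embedVec U j)).prod

lemma reflProd_mulVec {U : Op n} (hU : Uᴴ * U = 1) (l : List (Bits n)) (hl : l.Nodup)
    (j : Bits n) : reflProd U l *ᵥ joinState 0 (ket j) =
      if j ∈ l then joinState (U *ᵥ ket j) 0 else joinState 0 (ket j) := by
  induction l with
  | nil => simp [reflProd]
  | cons i l ih =>
    rw [List.nodup_cons] at hl
    have ih := ih hl.2
    simp only [reflProd, List.map_cons, List.prod_cons] at *
    rw [← mulVec_mulVec, ih]
    by_cases hij : i = j
    · subst hij
      rw [if_neg hl.1, if_pos List.mem_cons_self, refl_embedVec U, if_pos rfl]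
    · simp only [List.mem_cons, Ne.symm hij, false_or]
      split_ifs
      · exact refl_embedVec_of_ne hU hij
      · rw [refl_embedVec U, if_neg hij]

lemma Synth.reflProd {U : Op n} {L : ℕ} (h : ∀ j, ReflSynth (embedVec U j) L)
    (l : List (Bits n)) : Synth (reflProd U l) (l.length * L) := by
  induction l with
  | nil => simpa [CliffordT.reflProd] using Synth.one
  | cons j l ih =>
    exact ((h j 4).mul ih).mono (by rw [List.length_cons, add_mul, one_mul, add_comm])

lemma reflSynth_embedVec (hn : 1 ≤ n) {κ : ℕ} {U : Op n} (hU : Uᴴ * U = 1)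
    (hform : ∀ x y, HasForm κ (U x y)) (j : Bits n) :
    ReflSynth (embedVec U j) (648 * (n + 1) + 50 +
      ((κ + 1) * (2 * 2 ^ (n + 1)) + 2 * 2 ^ (n + 1)) * (2 * (1310 * (n + 1) + 212))) := by
  choose u hu using fun x => (hform x j).exists_octInt
  obtain ⟨s, hs⟩ := exists_octInt_sqrtTwo_pow κ
  have h0 := sqrtTwo_ne_zero
  let v : Bits (n + 1) → OctInt := fun z => if z (Fin.last n) = 0 then
    ⟨-(u fun i => z i.castSucc).a, -(u fun i => z i.castSucc).b, -(u fun i => z i.castSucc).c,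
      -(u fun i => z i.castSucc).d⟩
    else if (fun i => z i.castSucc) = j then s else ⟨0, 0, 0, 0⟩
  have hv : ∀ z, embedVec U j z = (v z).toComplex / sqrtTwo ^ (κ + 1) := by
    intro z
    simp only [embedVec, v]
    split_ifs
    · rw [hu, pow_succ]
      simp only [OctInt.toComplex]
      push_cast
      field_simp
      ring
    · rw [hs, pow_succ]; field_simp
    · simp [OctInt.toComplex]
  -- The exponent is κ + 1 because of the normalising factor 1/√2; the embedding qubit makes the
  -- number of qubits at least 2.
  refine (reflSynth_of_octInt (by omega) (κ + 1) v _ hv (embedVec_unit hU j)).mono ?_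
  refine Nat.add_le_add_left (Nat.mul_le_mul_right _ (Nat.add_le_add_left ?_ _)) _
  calc ∑ z, (v z).weight ≤ ∑ _z : Bits (n + 1), 2 := Finset.sum_le_sum fun z _ =>
        (v z).weight_le_two
    _ = 2 * 2 ^ (n + 1) := by simp [mul_comm]

lemma withAncillae_one_eq (ψ : Bits n → ℂ) : withAncillae 1 ψ = joinState ψ 0 := by
  ext z
  rw [withAncillae_one_apply]
  rfl

lemma pauliX_joinState (φ χ : Bits n → ℂ) :
    onQubit pauliX (Fin.last n) *ᵥ joinState φ χ = joinState χ φ := by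
  ext z
  have h01 : z (Fin.last n) = 0 ∨ z (Fin.last n) = 1 := by
    generalize z (Fin.last n) = a; revert a; decide
  have hu : ∀ b, (fun i : Fin n => update z (Fin.last n) b i.castSucc) = fun i => z i.castSucc := by
    intro b; ext i; rw [update_of_ne (Fin.castSucc_lt_last i).ne]
  rw [onQubit_mulVec, Fin.sum_univ_two]
  simp only [joinState, update_self, hu]
  rcases h01 with h | h <;> simp [h, pauliX]

lemma joinState_eq_sum (ψ : Bits n → ℂ) :
    joinState 0 ψ = ∑ j, ψ j • joinState 0 (ket j) := by
  ext z
  simp only [joinState, Finset.sum_apply, Pi.smul_apply, smul_eq_mul, ket]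
  split_ifs <;> simp [Pi.single_apply]

lemma joinState_mulVec_eq_sum (U : Op n) (ψ : Bits n → ℂ) :
    joinState (U *ᵥ ψ) 0 = ∑ j, ψ j • joinState (U *ᵥ ket j) 0 := by
  ext z
  simp only [joinState, Finset.sum_apply, Pi.smul_apply, smul_eq_mul, ket, mulVec_single_one,
    Matrix.col_apply]
  split_ifs
  · simp [mulVec, dotProduct, mul_comm]
  · simp

lemma reflProd_mul_pauliX_mulVec {U : Op n} (hU : Uᴴ * U = 1) (ψ : Bits n → ℂ) :
    (reflProd U Finset.univ.toList * onQubit pauliX (Fin.last n)) *ᵥ withAncillae 1 ψ =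
      withAncillae 1 (U *ᵥ ψ) := by
  rw [← mulVec_mulVec, withAncillae_one_eq, withAncillae_one_eq, pauliX_joinState,
    joinState_eq_sum, joinState_mulVec_eq_sum, mulVec_sum]
  refine Finset.sum_congr rfl fun j _ => ?_
  rw [mulVec_smul, reflProd_mulVec hU _ (Finset.nodup_toList _), if_pos (by simp)]

/-- The inner ancilla is the embedding qubit, the outer one the clean ancilla that `Synth` allows on
n + 1 qubits. -/
lemma withAncillae_two_eq (ψ : Bits n → ℂ) :
    (withAncillae 2 ψ : Bits (n + 2) → ℂ) = withAncillae (n := n + 1) 1 (withAncillae 1 ψ) := by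
  ext z
  rw [withAncillae_one_apply (n := n + 1), withAncillae_one_apply]
  simp only [withAncillae, Fin.forall_fin_two, ite_and]
  change (if z (Fin.last n).castSucc = 0 then if z (Fin.last (n + 1)) = 0 then
    ψ fun i => z i.castSucc.castSucc else 0 else 0) = _
  split_ifs <;> rfl

/-! ### The gate count and the conclusion. -/

lemma gate_count_le {n κ : ℕ} (hn : 1 ≤ n) (hκ : 1 ≤ κ) :
    2 ^ n * (648 * (n + 1) + 50 + ((κ + 1) * (2 * 2 ^ (n + 1)) + 2 * 2 ^ (n + 1)) *
      (2 * (1310 * (n + 1) + 212))) + 28 ≤ 70000 * (4 ^ n * n * κ) := by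
  have h4 : 4 ^ n = 2 ^ n * 2 ^ n := by rw [← mul_pow]; norm_num
  have hN : 1 ≤ 2 ^ n := Nat.one_le_two_pow
  rw [h4, pow_succ]
  generalize 2 ^ n = N at *
  have h1 : 648 * (n + 1) + 50 ≤ 1346 * (N * n * κ) := by
    have : n * 1 ≤ n * (N * κ) := Nat.mul_le_mul_left _ (Nat.mul_pos hN hκ)
    nlinarith
  -- With N = 2^n, the number of two-level steps is at most 4Nκ + 8N ≤ 12Nκ, and n + 1 ≤ 2n gives
  -- 5664 = 2(1310 · 2 + 212).
  have h2 : ((κ + 1) * (2 * (N * 2)) + 2 * (N * 2)) * (2 * (1310 * (n + 1) + 212)) ≤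
      (12 * (N * κ)) * (5664 * n) := by
    apply Nat.mul_le_mul
    · have : N * 1 ≤ N * κ := Nat.mul_le_mul_left _ hκ
      nlinarith
    · linarith
  have h3 : 28 ≤ 28 * (N * (N * n * κ)) :=
    Nat.le_mul_of_pos_right _ (Nat.mul_pos hN (Nat.mul_pos (Nat.mul_pos hN hn) hκ))
  calc _ ≤ N * (1346 * (N * n * κ) + (12 * (N * κ)) * (5664 * n)) + 28 * (N * (N * n * κ)) :=
        Nat.add_le_add (Nat.mul_le_mul_left _ (Nat.add_le_add h1 h2)) h3
    _ = 69342 * (N * N * n * κ) := by ring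
    _ ≤ _ := Nat.mul_le_mul_right _ (by norm_num)

end CliffordT

theorem theorem2 :
    ∃ K : ℕ, ∀ (n κ : ℕ), 1 ≤ n → 1 ≤ κ →
      ∀ U : CliffordT.Op n,
        U ∈ Matrix.unitaryGroup (CliffordT.Bits n) ℂ →
        (∀ x y, CliffordT.HasForm κ (U x y)) →
        ∃ a : ℕ, a ≤ 2 ∧ ∃ C : CliffordT.Circuit (n + a),
          CliffordT.Circuit.Implements C U ∧ C.length ≤ K * (4 ^ n * n * κ) := by
  refine ⟨70000, fun n κ hn hκ U hU hform => ⟨2, le_rfl, ?_⟩⟩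
  have hU' : U.conjTranspose * U = 1 := Matrix.mem_unitaryGroup_iff'.1 hU
  obtain ⟨C, hC, hl⟩ := (CliffordT.Synth.reflProd
    (CliffordT.reflSynth_embedVec hn hU' hform) Finset.univ.toList).mul
    (CliffordT.synthUnitary_pauliX (Fin.last n)).2.1
  refine ⟨C, fun ψ => ?_, hl.trans ?_⟩
  · rw [CliffordT.withAncillae_two_eq, CliffordT.withAncillae_two_eq,
      ← CliffordT.reflProd_mul_pauliX_mulVec hU']
    exact hC _
  · rw [Finset.length_toList, Finset.card_univ, Fintype.card_fun, Fintype.card_fin,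
      Fintype.card_fin]
    exact CliffordT.gate_count_le hn hκ
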